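/- Consider the (standard) remote-clique problem: given a finite metric space $(X,d)$ with $n$ points (as usual for this problem, distinct points at distance $0$ are allowed) and an integer $2\le k\le n$, find a set $T\subseteq X$ with $|T|=k$ maximizing $\mathrm{cl}(T)=\sum_{\{u,v\}\in\binom T2}d(u,v)$. The doubling dimension of $(X,d)$ is the smallest real $D\ge 0$ such that for all $u\in X$ and $r>0$ the closed ball of radius $r$ around $u$ can be covered by at most $2^D$ closed balls of radius $r/2$ centred at points of $X$. The model of computation is a real RAM: unit-cost addition, (truncated) subtraction and comparison of natural numbers, unit-cost field operations and comparison of real numbers, arrays with indirect addressing, and an oracle that returns the distance of two points, given by their numbers, in one time unit. Theorem. There are an algorithm, which takes $n$, $k$, a real $\varepsilon>0$ and the distance oracle as input, and an absolute constant $A>0$ such that for every real $D\ge 0$ there are constants $C_1,C_2>0$ depending only on $D$ with the following property. For every $\varepsilon>0$, every $n$-point metric space $(X,d)$ of doubling dimension at most $D$ and every integer $2\le k\le n$, the algorithm outputs a set $T\subseteq X$ with $|T|=k$ and \[ \mathrm{cl}(T)\ \ge\ (1-A\varepsilon)\cdot\max_{T'\subseteq X,\ |T'|=k}\mathrm{cl}(T')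 \] in time at most \[ C_1\, n\,(k+\varepsilon^{-D})\;+\;(\varepsilon^{-1}\log k)^{C_2\,\varepsilon^{-D}}\cdot k . \] That is, standard remote-clique over $n$-point metric spaces of constant doubling dimension $D$ admits a $(1-O(\varepsilon))$-approximation algorithm running in time $O(n(k+\varepsilon^{-D}))+(\varepsilon^{-1}\log k)^{O(\varepsilon^{-D})}\cdot k$, assuming constant-time distance evaluations. The algorithm needs no knowledge of $D$. -/

import Mathlib

/-! ### Remote-clique and the doubling dimension -/

section Metric

variable {X : Type*} [PseudoMetricSpace X]

/-- The (standard) remote-clique value of `T`: the sum of `d(u,v)` over unordered pairs in `T`. -/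
noncomputable def remoteClique (T : Finset X) : ℝ :=
  (1 / 2) * ∑ u ∈ T, ∑ v ∈ T, dist u v

variable (X) in
/-- Every closed ball of `X` is covered by at most `2 ^ D` closed balls of half its radius. -/
def HalfRadiusCover (D : ℝ) : Prop :=
  ∀ (u : X) (r : ℝ), 0 < r → ∃ V : Finset X, (V.card : ℝ) ≤ (2 : ℝ) ^ D ∧
    Metric.closedBall u r ⊆ ⋃ v ∈ V, Metric.closedBall v (r / 2)

variable (X) in
/-- The doubling dimension: the smallest `D ≥ 0` such that every ball can be covered by at most
`2 ^ D` balls of half its radius (for finite spaces the minimum exists, see below). -/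
noncomputable def doublingDim : ℝ :=
  sInf {D : ℝ | 0 ≤ D ∧ HalfRadiusCover X D}

variable (X) in
theorem isLeast_doublingDim [Finite X] :
    IsLeast {D : ℝ | 0 ≤ D ∧ HalfRadiusCover X D} (doublingDim X) := by
  classical
  have := Fintype.ofFinite X
  have hbdd : BddBelow {D : ℝ | 0 ≤ D ∧ HalfRadiusCover X D} := ⟨0, fun D hD => hD.1⟩
  have hne : {D : ℝ | 0 ≤ D ∧ HalfRadiusCover X D}.Nonempty := by
    refine ⟨Fintype.card X, by positivity, fun u r hr => ⟨Finset.univ, ?_, ?_⟩⟩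
    · rw [Real.rpow_natCast]
      exact_mod_cast (Nat.lt_two_pow_self (n := Fintype.card X)).le
    · intro x _
      simp only [Set.mem_iUnion]
      exact ⟨x, Finset.mem_univ x, Metric.mem_closedBall_self (by positivity)⟩
  refine ⟨⟨le_csInf hne fun D hD => hD.1, fun u r hr => ?_⟩, fun D hD => csInf_le hbdd hD⟩
  have hcont : Continuous fun D : ℝ => (2 : ℝ) ^ D :=
    Real.continuous_const_rpow (by norm_num)
  have hev : ∀ᶠ D in nhds (doublingDim X),
      (2 : ℝ) ^ D < (⌊(2 : ℝ) ^ doublingDim X⌋₊ : ℝ) + 1 :=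
    hcont.continuousAt.eventually_lt continuousAt_const (Nat.lt_floor_add_one _)
  obtain ⟨η, hη, hball⟩ := Metric.eventually_nhds_iff.1 hev
  obtain ⟨D, hD, hlt⟩ := exists_lt_of_csInf_lt hne
    (show sInf _ < doublingDim X + η from lt_add_of_pos_right _ hη)
  have hge : doublingDim X ≤ D := csInf_le hbdd hD
  obtain ⟨V, hV, hcov⟩ := hD.2 u r hr
  refine ⟨V, ?_, hcov⟩
  have h1 : (V.card : ℝ) < (⌊(2 : ℝ) ^ doublingDim X⌋₊ : ℝ) + 1 :=
    hV.trans_lt (hball (by rw [Real.dist_eq, abs_of_nonneg (by linarith)]; linarith))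
  have h2 : V.card ≤ ⌊(2 : ℝ) ^ doublingDim X⌋₊ := by
    exact Nat.lt_succ_iff.1 (by exact_mod_cast h1)
  exact (Nat.cast_le.2 h2).trans (Nat.floor_le (by positivity))

end Metric

/-! ### A real RAM with unit-cost distance evaluations

Programs are structured (`while`) programs over natural-number registers, real registers,
natural-number arrays and real arrays, each addressed by a name that is fixed in the program text;
array cells are reached by computed (indirect) indices.  Natural numbers only admit `+`, truncated
`-` and comparison, reals admit the field operations and comparison; there is no conversion from
reals to natural numbers (no floor function).  Distances are only available through an oracle
`dist i j`, whose evaluation is one unit-cost operation. -/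

namespace RealRAM

structure State where
  ireg : ℕ → ℕ
  rreg : ℕ → ℝ
  iarr : ℕ → ℕ → ℕ
  rarr : ℕ → ℕ → ℝ

/-- Natural-number expressions. -/
inductive IExpr where
  | const (m : ℕ)
  | reg (x : ℕ)
  | get (a : ℕ) (i : IExpr)
  | add (e₁ e₂ : IExpr)
  | sub (e₁ e₂ : IExpr)

/-- Real expressions. -/
inductive RExpr where
  | ofNat (e : IExpr)
  | reg (x : ℕ)
  | get (a : ℕ) (i : IExpr)
  | dist (i j : IExpr)
  | add (e₁ e₂ : RExpr)
  | sub (e₁ e₂ : RExpr)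
  | mul (e₁ e₂ : RExpr)
  | div (e₁ e₂ : RExpr)

/-- Tests. -/
inductive BExpr where
  | ile (e₁ e₂ : IExpr)
  | rle (e₁ e₂ : RExpr)
  | neg (b : BExpr)
  | conj (b₁ b₂ : BExpr)

/-- Programs. -/
inductive Prog where
  | skip
  | iset (x : ℕ) (e : IExpr)
  | rset (x : ℕ) (e : RExpr)
  | istore (a : ℕ) (i : IExpr) (e : IExpr)
  | rstore (a : ℕ) (i : IExpr) (e : RExpr)
  | seq (p q : Prog)
  | ite (b : BExpr) (p q : Prog)
  | loop (b : BExpr) (p : Prog)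

def IExpr.eval (s : State) : IExpr → ℕ
  | const m => m
  | reg x => s.ireg x
  | get a i => s.iarr a (i.eval s)
  | add e₁ e₂ => e₁.eval s + e₂.eval s
  | sub e₁ e₂ => e₁.eval s - e₂.eval s

/-- The parameter `d` is the distance oracle. -/
noncomputable def RExpr.eval (d : ℕ → ℕ → ℝ) (s : State) : RExpr → ℝ
  | ofNat e => (e.eval s : ℝ)
  | reg x => s.rreg x
  | get a i => s.rarr a (i.eval s)
  | dist i j => d (i.eval s) (j.eval s)
  | add e₁ e₂ => e₁.eval d s + e₂.eval d s
  | sub e₁ e₂ => e₁.eval d s - e₂.eval d s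
  | mul e₁ e₂ => e₁.eval d s * e₂.eval d s
  | div e₁ e₂ => e₁.eval d s / e₂.eval d s

def BExpr.eval (d : ℕ → ℕ → ℝ) (s : State) : BExpr → Prop
  | ile e₁ e₂ => e₁.eval s ≤ e₂.eval s
  | rle e₁ e₂ => e₁.eval d s ≤ e₂.eval d s
  | neg b => ¬ b.eval d s
  | conj b₁ b₂ => b₁.eval d s ∧ b₂.eval d s

/-- Evaluating an expression costs one time unit per constant, register access, array access,
operation and oracle call in it. -/
def IExpr.cost : IExpr → ℕ
  | const _ => 1
  | reg _ => 1
  | get _ i => 1 + i.cost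
  | add e₁ e₂ => 1 + e₁.cost + e₂.cost
  | sub e₁ e₂ => 1 + e₁.cost + e₂.cost

def RExpr.cost : RExpr → ℕ
  | ofNat e => 1 + e.cost
  | reg _ => 1
  | get _ i => 1 + i.cost
  | dist i j => 1 + i.cost + j.cost
  | add e₁ e₂ => 1 + e₁.cost + e₂.cost
  | sub e₁ e₂ => 1 + e₁.cost + e₂.cost
  | mul e₁ e₂ => 1 + e₁.cost + e₂.cost
  | div e₁ e₂ => 1 + e₁.cost + e₂.cost

def BExpr.cost : BExpr → ℕ
  | ile e₁ e₂ => 1 + e₁.cost + e₂.cost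
  | rle e₁ e₂ => 1 + e₁.cost + e₂.cost
  | neg b => 1 + b.cost
  | conj b₁ b₂ => 1 + b₁.cost + b₂.cost

def State.setIReg (s : State) (x v : ℕ) : State :=
  { s with ireg := Function.update s.ireg x v }

noncomputable def State.setRReg (s : State) (x : ℕ) (v : ℝ) : State :=
  { s with rreg := Function.update s.rreg x v }

def State.setIArr (s : State) (a i v : ℕ) : State :=
  { s with iarr := Function.update s.iarr a (Function.update (s.iarr a) i v) }

noncomputable def State.setRArr (s : State) (a i : ℕ) (v : ℝ) : State :=
  { s with rarr := Function.update s.rarr a (Function.update (s.rarr a) i v) }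

/-- `Exec d p s t s'`: with distance oracle `d`, program `p` started in state `s` halts in
state `s'` after exactly `t` time units. -/
inductive Exec (d : ℕ → ℕ → ℝ) : Prog → State → ℕ → State → Prop
  | skip (s : State) : Exec d .skip s 1 s
  | iset (s : State) (x : ℕ) (e : IExpr) :
      Exec d (.iset x e) s (1 + e.cost) (s.setIReg x (e.eval s))
  | rset (s : State) (x : ℕ) (e : RExpr) :
      Exec d (.rset x e) s (1 + e.cost) (s.setRReg x (e.eval d s))
  | istore (s : State) (a : ℕ) (i e : IExpr) :
      Exec d (.istore a i e) s (1 + i.cost + e.cost) (s.setIArr a (i.eval s) (e.eval s))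
  | rstore (s : State) (a : ℕ) (i : IExpr) (e : RExpr) :
      Exec d (.rstore a i e) s (1 + i.cost + e.cost) (s.setRArr a (i.eval s) (e.eval d s))
  | seq {p q : Prog} {s₁ s₂ s₃ : State} {t₁ t₂ : ℕ} :
      Exec d p s₁ t₁ s₂ → Exec d q s₂ t₂ s₃ → Exec d (.seq p q) s₁ (t₁ + t₂) s₃
  | iteTrue {b : BExpr} {p q : Prog} {s₁ s₂ : State} {t : ℕ} :
      b.eval d s₁ → Exec d p s₁ t s₂ → Exec d (.ite b p q) s₁ (1 + b.cost + t) s₂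
  | iteFalse {b : BExpr} {p q : Prog} {s₁ s₂ : State} {t : ℕ} :
      ¬ b.eval d s₁ → Exec d q s₁ t s₂ → Exec d (.ite b p q) s₁ (1 + b.cost + t) s₂
  | loopTrue {b : BExpr} {p : Prog} {s₁ s₂ s₃ : State} {t₁ t₂ : ℕ} :
      b.eval d s₁ → Exec d p s₁ t₁ s₂ → Exec d (.loop b p) s₂ t₂ s₃ →
      Exec d (.loop b p) s₁ (1 + b.cost + t₁ + t₂) s₃
  | loopFalse {b : BExpr} {p : Prog} {s : State} :
      ¬ b.eval d s → Exec d (.loop b p) s (1 + b.cost) s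

/-- Programs are deterministic: final state and running time are unique. -/
theorem Exec.unique {d : ℕ → ℕ → ℝ} {p : Prog} {s s₁ s₂ : State} {t₁ t₂ : ℕ}
    (h₁ : Exec d p s t₁ s₁) (h₂ : Exec d p s t₂ s₂) : t₁ = t₂ ∧ s₁ = s₂ := by
  induction h₁ generalizing t₂ s₂ with
  | skip | iset | rset | istore | rstore => cases h₂; exact ⟨rfl, rfl⟩
  | seq _ _ ih₁ ih₂ =>
    cases h₂ with
    | seq g₁ g₂ =>
      obtain ⟨rfl, rfl⟩ := ih₁ g₁
      obtain ⟨rfl, rfl⟩ := ih₂ g₂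
      exact ⟨rfl, rfl⟩
  | iteTrue hb _ ih =>
    cases h₂ with
    | iteTrue _ g => obtain ⟨rfl, rfl⟩ := ih g; exact ⟨rfl, rfl⟩
    | iteFalse hb₂ _ => exact absurd hb hb₂
  | iteFalse hb _ ih =>
    cases h₂ with
    | iteFalse _ g => obtain ⟨rfl, rfl⟩ := ih g; exact ⟨rfl, rfl⟩
    | iteTrue hb₂ _ => exact absurd hb₂ hb
  | loopTrue hb _ _ ih₁ ih₂ =>
    cases h₂ with
    | loopTrue _ g₁ g₂ =>
      obtain ⟨rfl, rfl⟩ := ih₁ g₁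
      obtain ⟨rfl, rfl⟩ := ih₂ g₂
      exact ⟨rfl, rfl⟩
    | loopFalse hb₂ => exact absurd hb hb₂
  | loopFalse hb =>
    cases h₂ with
    | loopFalse _ => exact ⟨rfl, rfl⟩
    | loopTrue hb₂ _ _ => exact absurd hb₂ hb

/-- The initial state on input `n`, `k`, `ε`; all other memory cells are zero. -/
noncomputable def initState (n k : ℕ) (ε : ℝ) : State where
  ireg x := if x = 0 then n else if x = 1 then k else 0
  rreg x := if x = 0 then ε else 0
  iarr _ _ := 0
  rarr _ _ := 0

/-- The distance oracle of a space whose points are numbered `0, …, n - 1` by `e`. -/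
noncomputable def oracle {X : Type*} [PseudoMetricSpace X] {n : ℕ} (e : Fin n ≃ X) (i j : ℕ) : ℝ :=
  if h : i < n ∧ j < n then dist (e ⟨i, h.1⟩) (e ⟨j, h.2⟩) else 0

/-- The first `k` cells of array `0` list the points of `T` by their numbers, each exactly once. -/
def Outputs {X : Type*} {n : ℕ} (e : Fin n ≃ X) (k : ℕ) (s : State) (T : Finset X) : Prop :=
  ∃ f : Fin k ↪ X, T = Finset.univ.map f ∧ ∀ i : Fin k, s.iarr 0 i = (e.symm (f i) : ℕ)

end RealRAM

/-!
The algorithm first walks `k - 1` steps through the space, from each point to a farthest unvisited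
one. Let `W` be the length of this walk and `z` its last point. The visited points show that the
optimum is at least `k * W / 4` (`FarWalk.mul_le_cliqueVal`), while the distances from `z` to any
`k` points add up to at most `5 * W` (`FarWalk.sum_le`). So `W / k` is the right scale and `z` is
central. Exchanging one point shows that all points more than `25 * W / k` away from `z` belong to
every optimal set (`FarWalk.mem_of_far`), and these far points are simply taken.

The remaining points lie in a ball of radius `25 * W / k`; they are clustered greedily around
centers that are more than `ε * W / k` apart, and by the doubling property there are
`m ≤ (100 / ε) ^ D` of them (`card_net_le`). Up to an error `ε * k * W`, which is `O(ε)` times the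
optimum, only the numbers of points taken from each cluster matter (`Clustering.abs_sub_le`,
`Clustering.sum_rep_eq`). Rounding these numbers down to multiples of `q`, the least positive
integer with `ε * k < q * m`, drops at most `ε * k` points of an optimal set; each is near, so it
contributes at most `30 * W`. Hence it is enough to search all vectors of multiples of `q` for the
best one, to output that many points from each cluster, and to fill up to `k` points
(`Clustering.approx`). There are `(k / q + 1) ^ m ≤ (2 * m / ε) ^ m` such vectors, and
`ε⁻¹ * log k` is at least `2` and at least `ε⁻¹ ^ (1 / 2)` when `128 * ε < 1`, so that the search
fits into the second term of the time bound (`search_time_le`); no knowledge of `D` is needed. For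
`128 * ε ≥ 1` the guarantee is void and any `k` points are output.

Programs are verified by a total-correctness judgement with a time bound, `Runs`: loop-free code is
handled by weakest preconditions (`Runs.of_wp`), loops by invariants that are indexed by the number
of rounds (`Runs.loop`, `Runs.forN`), and unmodified memory by the frame relation `Same`.
-/

/-! ### Verification of RAM programs -/

namespace RealRAM

variable {d : ℕ → ℕ → ℝ}

namespace State

@[simp] theorem ireg_setIReg (s : State) (x v y : ℕ) :
    (s.setIReg x v).ireg y = if y = x then v else s.ireg y := by
  simp [setIReg, Function.update_apply]

@[simp] theorem rreg_setIReg (s : State) (x v : ℕ) : (s.setIReg x v).rreg = s.rreg := rfl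
@[simp] theorem iarr_setIReg (s : State) (x v : ℕ) : (s.setIReg x v).iarr = s.iarr := rfl
@[simp] theorem rarr_setIReg (s : State) (x v : ℕ) : (s.setIReg x v).rarr = s.rarr := rfl

@[simp] theorem rreg_setRReg (s : State) (x : ℕ) (v : ℝ) (y : ℕ) :
    (s.setRReg x v).rreg y = if y = x then v else s.rreg y := by
  simp [setRReg, Function.update_apply]

@[simp] theorem ireg_setRReg (s : State) (x : ℕ) (v : ℝ) : (s.setRReg x v).ireg = s.ireg := rfl
@[simp] theorem iarr_setRReg (s : State) (x : ℕ) (v : ℝ) : (s.setRReg x v).iarr = s.iarr := rfl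

@[simp] theorem iarr_setIArr (s : State) (a i v b j : ℕ) :
    (s.setIArr a i v).iarr b j = if b = a ∧ j = i then v else s.iarr b j := by
  by_cases hb : b = a
  · subst hb; simp [setIArr, Function.update_apply]
  · simp [setIArr, hb]

@[simp] theorem ireg_setIArr (s : State) (a i v : ℕ) : (s.setIArr a i v).ireg = s.ireg := rfl
@[simp] theorem rreg_setIArr (s : State) (a i v : ℕ) : (s.setIArr a i v).rreg = s.rreg := rfl

@[simp] theorem rarr_setRArr (s : State) (a i : ℕ) (v : ℝ) (b j : ℕ) :
    (s.setRArr a i v).rarr b j = if b = a ∧ j = i then v else s.rarr b j := by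
  by_cases hb : b = a
  · subst hb; simp [setRArr, Function.update_apply]
  · simp [setRArr, hb]

@[simp] theorem ireg_setRArr (s : State) (a i : ℕ) (v : ℝ) : (s.setRArr a i v).ireg = s.ireg := rfl

end State

namespace Prog

/-- The natural-number registers that a program may write. -/
def modI : Prog → List ℕ
  | iset x _ => [x]
  | seq p q => p.modI ++ q.modI
  | ite _ p q => p.modI ++ q.modI
  | loop _ p => p.modI
  | _ => []

/-- The real registers that a program may write. -/
def modR : Prog → List ℕ
  | rset x _ => [x]
  | seq p q => p.modR ++ q.modR
  | ite _ p q => p.modR ++ q.modR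
  | loop _ p => p.modR
  | _ => []

/-- The natural-number arrays that a program may write. -/
def modIA : Prog → List ℕ
  | istore a _ _ => [a]
  | seq p q => p.modIA ++ q.modIA
  | ite _ p q => p.modIA ++ q.modIA
  | loop _ p => p.modIA
  | _ => []

/-- The real arrays that a program may write. -/
def modRA : Prog → List ℕ
  | rstore a _ _ => [a]
  | seq p q => p.modRA ++ q.modRA
  | ite _ p q => p.modRA ++ q.modRA
  | loop _ p => p.modRA
  | _ => []

/-- The largest possible running time of a loop-free program (a loop counts as `0`, which is
harmless since `Prog.wp` is `False` on loops). -/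
def maxCost : Prog → ℕ
  | skip => 1
  | iset _ e => 1 + e.cost
  | rset _ e => 1 + e.cost
  | istore _ i e => 1 + i.cost + e.cost
  | rstore _ i e => 1 + i.cost + e.cost
  | seq p q => p.maxCost + q.maxCost
  | ite b p q => 1 + b.cost + max p.maxCost q.maxCost
  | loop _ _ => 0

/-- The weakest precondition of a loop-free program. -/
def wp (d : ℕ → ℕ → ℝ) : Prog → (State → Prop) → State → Prop
  | skip, Q, s => Q s
  | iset x e, Q, s => Q (s.setIReg x (e.eval s))
  | rset x e, Q, s => Q (s.setRReg x (e.eval d s))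
  | istore a i e, Q, s => Q (s.setIArr a (i.eval s) (e.eval s))
  | rstore a i e, Q, s => Q (s.setRArr a (i.eval s) (e.eval d s))
  | seq p q, Q, s => p.wp d (q.wp d Q) s
  | ite b p q, Q, s => (b.eval d s → p.wp d Q s) ∧ (¬ b.eval d s → q.wp d Q s)
  | loop _ _, _, _ => False

/-- `for x := 0, …, e - 1 do p`. -/
def forN (x : ℕ) (e : IExpr) (p : Prog) : Prog :=
  .seq (.iset x (.const 0))
    (.loop (.ile (.add (.reg x) (.const 1)) e) (.seq p (.iset x (.add (.reg x) (.const 1)))))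

end Prog

/-- `s` and `s'` agree on all memory that the text of `p` does not write. -/
structure Same (p : Prog) (s s' : State) : Prop where
  i : ∀ x, x ∉ p.modI → s'.ireg x = s.ireg x
  r : ∀ x, x ∉ p.modR → s'.rreg x = s.rreg x
  ia : ∀ a, a ∉ p.modIA → s'.iarr a = s.iarr a
  ra : ∀ a, a ∉ p.modRA → s'.rarr a = s.rarr a

theorem Same.refl (p : Prog) (s : State) : Same p s s :=
  ⟨fun _ _ => rfl, fun _ _ => rfl, fun _ _ => rfl, fun _ _ => rfl⟩

theorem Same.trans {p : Prog} {s₁ s₂ s₃ : State} (h : Same p s₁ s₂) (h' : Same p s₂ s₃) :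
    Same p s₁ s₃ :=
  ⟨fun x hx => (h'.i x hx).trans (h.i x hx), fun x hx => (h'.r x hx).trans (h.r x hx),
    fun x hx => (h'.ia x hx).trans (h.ia x hx), fun x hx => (h'.ra x hx).trans (h.ra x hx)⟩

/-- The frame property: memory that a program text does not mention as a target is unchanged. -/
theorem Exec.same {p : Prog} {s s' : State} {t : ℕ} (h : Exec d p s t s') : Same p s s' := by
  induction h with
  | skip s => exact .refl _ _
  | iset s x e =>
    refine ⟨fun y hy => ?_, fun _ _ => rfl, fun _ _ => rfl, fun _ _ => rfl⟩
    simp only [Prog.modI, List.mem_singleton] at hy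
    simp [hy]
  | rset s x e =>
    refine ⟨fun _ _ => rfl, fun y hy => ?_, fun _ _ => rfl, fun _ _ => rfl⟩
    simp only [Prog.modR, List.mem_singleton] at hy
    simp [hy]
  | istore s a i e =>
    refine ⟨fun _ _ => rfl, fun _ _ => rfl, fun b hb => ?_, fun _ _ => rfl⟩
    simp only [Prog.modIA, List.mem_singleton] at hb
    funext j; simp [hb]
  | rstore s a i e =>
    refine ⟨fun _ _ => rfl, fun _ _ => rfl, fun _ _ => rfl, fun b hb => ?_⟩
    simp only [Prog.modRA, List.mem_singleton] at hb
    funext j; simp [hb]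
  | seq _ _ h₁ h₂ =>
    constructor <;> intro x hx <;>
      simp only [Prog.modI, Prog.modR, Prog.modIA, Prog.modRA, List.mem_append, not_or] at hx
    exacts [(h₂.i x hx.2).trans (h₁.i x hx.1), (h₂.r x hx.2).trans (h₁.r x hx.1),
      (h₂.ia x hx.2).trans (h₁.ia x hx.1), (h₂.ra x hx.2).trans (h₁.ra x hx.1)]
  | iteTrue _ _ h₁ =>
    constructor <;> intro x hx <;>
      simp only [Prog.modI, Prog.modR, Prog.modIA, Prog.modRA, List.mem_append, not_or] at hx
    exacts [h₁.i x hx.1, h₁.r x hx.1, h₁.ia x hx.1, h₁.ra x hx.1]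
  | iteFalse _ _ h₁ =>
    constructor <;> intro x hx <;>
      simp only [Prog.modI, Prog.modR, Prog.modIA, Prog.modRA, List.mem_append, not_or] at hx
    exacts [h₁.i x hx.2, h₁.r x hx.2, h₁.ia x hx.2, h₁.ra x hx.2]
  | loopTrue _ _ _ h₁ h₂ =>
    exact Same.trans ⟨h₁.i, h₁.r, h₁.ia, h₁.ra⟩ h₂
  | loopFalse _ => exact .refl _ _

/-- Total correctness with a time bound: `p` started in `s` halts within `B` time units in a
state that satisfies `Q`. -/
def Runs (d : ℕ → ℕ → ℝ) (p : Prog) (s : State) (B : ℕ) (Q : State → Prop) : Prop :=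
  ∃ t s', Exec d p s t s' ∧ t ≤ B ∧ Q s'

namespace Runs

variable {p q : Prog} {s : State} {B B₁ B₂ : ℕ} {Q R : State → Prop}

theorem mono (h : Runs d p s B₁ R) (hB : B₁ ≤ B₂) (hQ : ∀ s', Same p s s' → R s' → Q s') :
    Runs d p s B₂ Q := by
  obtain ⟨t, s', h₁, h₂, h₃⟩ := h
  exact ⟨t, s', h₁, h₂.trans hB, hQ _ h₁.same h₃⟩

theorem seq (h₁ : Runs d p s B₁ R) (h₂ : ∀ s', Same p s s' → R s' → Runs d q s' B₂ Q) :
    Runs d (.seq p q) s (B₁ + B₂) Q := by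
  obtain ⟨t, s', h, ht, hR⟩ := h₁
  obtain ⟨t', s'', h', ht', hQ⟩ := h₂ s' h.same hR
  exact ⟨_, _, .seq h h', Nat.add_le_add ht ht', hQ⟩

theorem ite {b : BExpr} (h₁ : b.eval d s → Runs d p s B Q) (h₂ : ¬ b.eval d s → Runs d q s B Q) :
    Runs d (.ite b p q) s (1 + b.cost + B) Q := by
  by_cases hb : b.eval d s
  · obtain ⟨t, s', h, ht, hQ⟩ := h₁ hb
    exact ⟨_, _, .iteTrue hb h, by omega, hQ⟩
  · obtain ⟨t, s', h, ht, hQ⟩ := h₂ hb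
    exact ⟨_, _, .iteFalse hb h, by omega, hQ⟩

theorem of_wp (h : p.wp d Q s) : Runs d p s p.maxCost Q := by
  induction p generalizing s Q with
  | skip => exact ⟨_, _, .skip _, le_rfl, h⟩
  | iset x e => exact ⟨_, _, .iset _ _ _, le_rfl, h⟩
  | rset x e => exact ⟨_, _, .rset _ _ _, le_rfl, h⟩
  | istore a i e => exact ⟨_, _, .istore _ _ _ _, le_rfl, h⟩
  | rstore a i e => exact ⟨_, _, .rstore _ _ _ _, le_rfl, h⟩
  | seq p q ihp ihq => exact (ihp h).seq fun s' _ hs' => ihq hs'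
  | ite b p q ihp ihq =>
    exact Runs.ite (fun hb => (ihp (h.1 hb)).mono (le_max_left _ _) fun _ _ => id)
      (fun hb => (ihq (h.2 hb)).mono (le_max_right _ _) fun _ _ => id)
  | loop b p => exact h.elim

/-- A loop that is left after exactly `N` rounds. -/
theorem loop {b : BExpr} {N : ℕ} {I : ℕ → State → Prop} (h₀ : I 0 s)
    (hstep : ∀ i s', i < N → Same (.loop b p) s s' → I i s' →
      b.eval d s' ∧ Runs d p s' B (I (i + 1)))
    (hend : ∀ s', Same (.loop b p) s s' → I N s' → ¬ b.eval d s') :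
    Runs d (.loop b p) s (1 + b.cost + N * (1 + b.cost + B)) (I N) := by
  have key : ∀ j i s', i + j = N → Same (.loop b p) s s' → I i s' →
      Runs d (.loop b p) s' (1 + b.cost + j * (1 + b.cost + B)) (I N) := by
    intro j
    induction j with
    | zero =>
      intro i s' hi hs hI
      obtain rfl : i = N := hi
      exact ⟨_, _, .loopFalse (hend s' hs hI), by omega, hI⟩
    | succ j ih =>
      intro i s' hi hs hI
      obtain ⟨hb, t₁, s₁, h₁, ht₁, hI₁⟩ := hstep i s' (by omega) hs hI
      have hsame : Same (.loop b p) s' s₁ :=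
        ⟨h₁.same.i, h₁.same.r, h₁.same.ia, h₁.same.ra⟩
      obtain ⟨t₂, s₂, h₂, ht₂, hI₂⟩ := ih (i + 1) s₁ (by omega) (hs.trans hsame) hI₁
      refine ⟨_, _, .loopTrue hb h₁ h₂, ?_, hI₂⟩
      rw [Nat.succ_mul]
      omega
  exact key N 0 s (by omega) (.refl _ _) h₀

theorem forN {x : ℕ} {e : IExpr} {N : ℕ} {I : ℕ → State → Prop}
    (h₀ : I 0 (s.setIReg x 0))
    (he : ∀ i s', Same (.forN x e p) s s' → I i s' → e.eval s' = N)
    (hstep : ∀ i s', i < N → Same (.forN x e p) s s' → I i s' → s'.ireg x = i →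
      Runs d p s' B fun s'' => s''.ireg x = i ∧ I (i + 1) (s''.setIReg x (i + 1))) :
    Runs d (.forN x e p) s (7 + e.cost + N * (9 + e.cost + B)) (I N) := by
  have hfirst : Runs d (.iset x (.const 0)) s 2 fun s' => s' = s.setIReg x 0 :=
    ⟨_, _, .iset _ _ _, le_rfl, rfl⟩
  refine (hfirst.seq (B₂ := 5 + e.cost + N * (9 + e.cost + B)) fun s₀ hsame₀ hs₀ => ?_).mono
    (by omega) fun _ _ => id
  subst hs₀
  have hemb : ∀ s', Same (.loop (.ile (.add (.reg x) (.const 1)) e)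
      (.seq p (.iset x (.add (.reg x) (.const 1))))) (s.setIReg x 0) s' →
      Same (.forN x e p) s s' := by
    intro s' h
    constructor <;> intro y hy <;>
      simp only [Prog.forN, Prog.modI, Prog.modR, Prog.modIA, Prog.modRA, List.mem_append,
        not_or] at hy
    · rw [h.i y (by simp [Prog.modI, hy.2.1, hy.2.2])]
      simp only [State.ireg_setIReg]
      rw [if_neg (by simpa using hy.1)]
    · exact h.r y (by simp [Prog.modR, hy])
    · exact h.ia y (by simp [Prog.modIA, hy])
    · exact h.ra y (by simp [Prog.modRA, hy])
  refine (Runs.loop (N := N) (B := B + 4) (I := fun i s' => s'.ireg x = i ∧ I i s')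
    ⟨by simp, h₀⟩ ?_ ?_).mono ?_ (fun _ _ h => h.2)
  · rintro i s' hi hs ⟨hx, hI⟩
    refine ⟨?_, ?_⟩
    · simp only [BExpr.eval, IExpr.eval, he i s' (hemb _ hs) hI, hx]
      omega
    · refine (hstep i s' hi (hemb _ hs) hI hx).seq fun s₁ _ ⟨hx₁, hI₁⟩ =>
        ⟨_, _, .iset _ _ _, le_rfl, ?_⟩
      simp only [IExpr.eval, hx₁]
      exact ⟨by simp, hI₁⟩
  · rintro s' hs ⟨hx, hI⟩
    simp only [BExpr.eval, IExpr.eval, he N s' (hemb _ hs) hI, hx]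
    omega
  · simp only [BExpr.cost, IExpr.cost]
    have : N * (1 + (1 + (1 + 1 + 1) + e.cost) + (B + 4)) = N * (9 + e.cost + B) := by
      congr 1; omega
    omega

end Runs

end RealRAM

/-! ### Remote-clique on numbered points -/

namespace RealRAM

open Finset

/-- `d` is a pseudometric on `{0, …, n - 1}`, and vanishes as soon as one index is out of range
(this is why only the middle index of the triangle inequality is restricted). -/
structure IsPMetric (d : ℕ → ℕ → ℝ) (n : ℕ) : Prop where
  nonneg : ∀ i j, 0 ≤ d i j
  self : ∀ i, d i i = 0
  symm : ∀ i j, d i j = d j i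
  tri : ∀ i j l, j < n → d i l ≤ d i j + d j l

theorem isPMetric_oracle {X : Type*} [PseudoMetricSpace X] {n : ℕ} (e : Fin n ≃ X) :
    IsPMetric (oracle e) n where
  nonneg i j := by unfold oracle; split_ifs <;> positivity
  self i := by unfold oracle; split_ifs <;> simp
  symm i j := by
    unfold oracle
    by_cases hi : i < n <;> by_cases hj : j < n <;> simp [hi, hj]
    exact dist_comm _ _
  tri i j l hj := by
    unfold oracle
    by_cases hi : i < n <;> by_cases hl : l < n <;> simp [hi, hj, hl, dist_triangle]

/-- The remote-clique value of a set of point numbers. -/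
noncomputable def cliqueVal (d : ℕ → ℕ → ℝ) (T : Finset ℕ) : ℝ :=
  (1 / 2) * ∑ u ∈ T, ∑ v ∈ T, d u v

variable {d : ℕ → ℕ → ℝ} {n : ℕ}

theorem IsPMetric.cliqueVal_mono (hd : IsPMetric d n) {S T : Finset ℕ} (h : S ⊆ T) :
    cliqueVal d S ≤ cliqueVal d T := by
  unfold cliqueVal
  refine mul_le_mul_of_nonneg_left ?_ (by norm_num)
  calc ∑ u ∈ S, ∑ v ∈ S, d u v ≤ ∑ u ∈ S, ∑ v ∈ T, d u v :=
        sum_le_sum fun u _ => sum_le_sum_of_subset_of_nonneg h fun v _ _ => hd.nonneg u v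
    _ ≤ ∑ u ∈ T, ∑ v ∈ T, d u v :=
        sum_le_sum_of_subset_of_nonneg h fun u _ _ => sum_nonneg fun v _ => hd.nonneg u v

theorem IsPMetric.cliqueVal_insert (hd : IsPMetric d n) {S : Finset ℕ} {u : ℕ} (hu : u ∉ S) :
    cliqueVal d (insert u S) = cliqueVal d S + ∑ w ∈ S, d u w := by
  unfold cliqueVal
  simp only [sum_insert hu, hd.self, sum_add_distrib]
  have : ∑ x ∈ S, d x u = ∑ x ∈ S, d u x := sum_congr rfl fun x _ => hd.symm x u
  rw [this]
  ring

theorem IsPMetric.cliqueVal_le_of_subset (hd : IsPMetric d n) {S T : Finset ℕ} {B : ℝ}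
    (h : S ⊆ T) (hB : ∀ u ∈ T \ S, ∑ w ∈ T, d u w ≤ B) :
    cliqueVal d T ≤ cliqueVal d S + (T \ S).card * B := by
  have h1 : ∑ u ∈ T \ S, ∑ w ∈ T, d u w ≤ (T \ S).card * B := by
    simpa using sum_le_card_nsmul _ _ _ hB
  have h2 : ∑ u ∈ S, ∑ v ∈ T \ S, d u v ≤ (T \ S).card * B := by
    rw [sum_comm]
    refine le_trans (sum_le_sum fun u _ => ?_) h1
    calc ∑ x ∈ S, d x u = ∑ x ∈ S, d u x := sum_congr rfl fun x _ => hd.symm x u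
      _ ≤ _ := sum_le_sum_of_subset_of_nonneg h fun v _ _ => hd.nonneg u v
  have h3 : ∑ u ∈ S, ∑ v ∈ T, d u v = ∑ u ∈ S, ∑ v ∈ T \ S, d u v + ∑ u ∈ S, ∑ v ∈ S, d u v := by
    rw [← sum_add_distrib]
    exact sum_congr rfl fun u _ => (sum_sdiff h).symm
  unfold cliqueVal
  rw [← sum_sdiff h, h3]
  linarith

/-! ### A central point and the scale of the optimum -/

/-- The invariant of the farthest-point walk: `V` is the set of visited points, `z` the current
point, `W` the length of the walk, and each step goes to an unvisited point that is farthest from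
the current one. -/
structure FarWalk (d : ℕ → ℕ → ℝ) (n : ℕ) (V : Finset ℕ) (z : ℕ) (W : ℝ) : Prop where
  sub : V ⊆ range n
  mem : z ∈ V
  nonneg : 0 ≤ W
  lower : ∀ w < n, W + d w z ≤ 2 * ∑ v ∈ V, d w v
  visited : ∀ a < n, (a ∉ V ∨ a = z) → ∑ v ∈ V, d v a ≤ W + d z a
  rest : ∀ a b, a < n → b < n → a ∉ V → (b ∉ V ∨ b = z) → ((V.card : ℝ) - 1) * d a b ≤ 2 * W

theorem FarWalk.singleton (hd : IsPMetric d n) (hn : 0 < n) : FarWalk d n {0} 0 0 where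
  sub := by simpa using hn
  mem := by simp
  nonneg := le_rfl
  lower w _ := by simp; linarith [hd.nonneg w 0]
  visited a _ _ := by simp
  rest a b _ _ _ _ := by simp

/-- The invariant survives a step to a farthest unvisited point `y`. Points that are unvisited
after a step are at most twice its length apart; adding up over all steps gives `rest`. -/
theorem FarWalk.step (hd : IsPMetric d n) {V : Finset ℕ} {z y : ℕ} {W : ℝ} (h : FarWalk d n V z W)
    (hy : y < n) (hyV : y ∉ V) (hfar : ∀ u < n, u ∉ V → d z u ≤ d z y) :
    FarWalk d n (insert y V) y (W + d z y) where
  sub := by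
    intro u hu
    rcases mem_insert.1 hu with rfl | hu
    · simpa using hy
    · exact h.sub hu
  mem := mem_insert_self _ _
  nonneg := add_nonneg h.nonneg (hd.nonneg _ _)
  lower w hw := by
    rw [sum_insert hyV]
    linarith [h.lower w hw, hd.tri z w y hw, hd.symm z w]
  visited a ha hay := by
    rw [sum_insert hyV]
    rcases hay with hay | rfl
    · simp only [mem_insert, not_or] at hay
      linarith [h.visited a ha (.inl hay.2), hfar a ha hay.2]
    · linarith [h.visited a ha (.inl hyV)]
  rest a b ha hb haV hbV := by
    have hzn : z < n := by simpa using h.sub h.mem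
    simp only [mem_insert, not_or] at haV
    have hb' : b ∉ V := by
      rcases hbV with hbV | rfl
      · simp only [mem_insert, not_or] at hbV; exact hbV.2
      · exact hyV
    rw [card_insert_of_notMem hyV]
    push_cast
    linarith [h.rest a b ha hb haV.2 (.inl hb'), hd.tri a z b hzn, hfar a ha haV.2, hfar b hb hb',
      hd.symm a z]

/-- The last point of the walk is central for every set of `k` points: a visited point is charged to
the step that leaves it, an unvisited one to the average step. -/
theorem FarWalk.sum_le (hd : IsPMetric d n) {V T : Finset ℕ} {z k : ℕ} {W : ℝ}
    (h : FarWalk d n V z W) (hV : V.card = k) (hk : 2 ≤ k) (hT : T ⊆ range n) (hTk : T.card = k) :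
    ∑ u ∈ T, d u z ≤ 5 * W := by
  have hz : z < n := by simpa using h.sub h.mem
  have hk' : (2 : ℝ) ≤ k := by exact_mod_cast hk
  have h1 : ∑ u ∈ T.filter (· ∈ V), d u z ≤ W := by
    refine le_trans (sum_le_sum_of_subset_of_nonneg (fun u hu => (mem_filter.1 hu).2)
      fun u _ _ => hd.nonneg u z) ?_
    simpa [hd.self] using h.visited z hz (.inr rfl)
  have h2 : ∑ u ∈ T.filter (· ∉ V), d u z ≤ 4 * W := by
    have h3 : ∀ u ∈ T.filter (· ∉ V), d u z ≤ 2 * W / (k - 1) := by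
      intro u hu
      rw [mem_filter] at hu
      rw [le_div_iff₀ (by linarith), mul_comm]
      have := h.rest u z (by simpa using hT hu.1) hz hu.2 (.inr rfl)
      rwa [hV] at this
    refine (sum_le_card_nsmul _ _ _ h3).trans ?_
    have hc : ((T.filter (· ∉ V)).card : ℝ) ≤ k := by
      rw [← hTk]; exact_mod_cast card_filter_le _ _
    rw [nsmul_eq_mul, mul_div_assoc', div_le_iff₀ (by linarith)]
    have := h.nonneg
    nlinarith
  rw [← sum_filter_add_sum_filter_not T (· ∈ V)]
  linarith

/-- The visited points themselves witness that the optimum has order `k * W`. -/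
theorem FarWalk.mul_le_cliqueVal {V : Finset ℕ} {z : ℕ} {W : ℝ} (hd : IsPMetric d n)
    (h : FarWalk d n V z W) : V.card * W ≤ 4 * cliqueVal d V := by
  have h1 : ∑ w ∈ V, W ≤ ∑ w ∈ V, 2 * ∑ v ∈ V, d w v := sum_le_sum fun w hw => by
    linarith [h.lower w (by simpa using h.sub hw), hd.nonneg w z]
  rw [sum_const, nsmul_eq_mul, ← mul_sum] at h1
  unfold cliqueVal
  linarith

/-- A point that is far from `z` belongs to every optimal set: otherwise it could be exchanged for
a point of the optimal set that is close to `z`. -/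
theorem FarWalk.mem_of_far (hd : IsPMetric d n) {V T : Finset ℕ} {z k u : ℕ} {W : ℝ}
    (h : FarWalk d n V z W) (hV : V.card = k) (hk : 2 ≤ k) (hT : T ⊆ range n) (hTk : T.card = k)
    (hmax : ∀ T' ⊆ range n, T'.card = k → cliqueVal d T' ≤ cliqueVal d T)
    (hu : u < n) (hfar : 25 * W / k < d z u) : u ∈ T := by
  by_contra huT
  have hz : z < n := by simpa using h.sub h.mem
  have hk' : (2 : ℝ) ≤ k := by exact_mod_cast hk
  have hsum := h.sum_le hd hV hk hT hTk
  obtain ⟨v, hv, hvz⟩ : ∃ v ∈ T, d v z ≤ 5 * W / k := by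
    by_contra! hcon
    have := sum_lt_sum_of_nonempty (card_pos.1 (by omega)) hcon
    rw [sum_const, hTk, nsmul_eq_mul, mul_div_cancel₀ _ (by positivity)] at this
    linarith
  have huS : u ∉ T.erase v := fun h => huT (mem_of_mem_erase h)
  have h1 := hmax (insert u (T.erase v))
    (insert_subset (by simpa using hu) ((erase_subset _ _).trans hT))
    (by rw [card_insert_of_notMem huS, card_erase_of_mem hv]; omega)
  rw [hd.cliqueVal_insert huS] at h1
  have hTv := hd.cliqueVal_insert (notMem_erase v T)
  rw [insert_erase hv] at hTv
  have h2 : ∑ w ∈ T.erase v, (d z u - d v z - 2 * d w z) ≤ ∑ w ∈ T.erase v, (d u w - d v w) := by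
    refine sum_le_sum fun w hw => ?_
    have hw : w < n := by simpa using hT (mem_of_mem_erase hw)
    linarith [hd.tri z w u hw, hd.tri v z w hz, hd.symm z w, hd.symm u w]
  simp only [sum_sub_distrib, sum_const, nsmul_eq_mul, ← mul_sum, card_erase_of_mem hv, hTk] at h2
  rw [Nat.cast_sub (by omega), Nat.cast_one] at h2
  have h3 : ∑ w ∈ T.erase v, d w z ≤ 5 * W :=
    (sum_le_sum_of_subset_of_nonneg (erase_subset _ _) fun w _ _ => hd.nonneg w z).trans hsum
  have h4 : 20 * W / k < d z u - d v z := by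
    have : 25 * W / k = 20 * W / k + 5 * W / k := by ring
    linarith
  have h5 : ((k : ℝ) - 1) * (20 * W / k) < (k - 1) * (d z u - d v z) :=
    mul_lt_mul_of_pos_left h4 (by linarith)
  have h6 : 10 * W ≤ ((k : ℝ) - 1) * (20 * W / k) := by
    rw [mul_div_assoc', le_div_iff₀ (by linarith)]
    nlinarith [h.nonneg]
  linarith

/-! ### Clusterings and vectors of multiplicities -/

/-- The points of cluster `j`. Cluster `0` collects the far points. -/
def cell (n : ℕ) (a : ℕ → ℕ) (j : ℕ) : Finset ℕ := (range n).filter (a · = j)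

theorem mem_cell {a : ℕ → ℕ} {j u : ℕ} : u ∈ cell n a j ↔ u < n ∧ a u = j := by simp [cell]

/-- A partition of the points into the far points (label `0`, more than `ρ` away from `z`) and `m`
clusters (labels `1, …, m`) of radius `η`; the cluster with label `j + 1` is centred at `c j`. -/
structure Clustering (d : ℕ → ℕ → ℝ) (n z : ℕ) (ρ η : ℝ) (a c : ℕ → ℕ) (m : ℕ) : Prop where
  center_lt : ∀ j < m, c j < n
  label_le : ∀ u < n, a u ≤ m
  far : ∀ u < n, a u = 0 ↔ ρ < d z u
  near : ∀ u < n, a u ≠ 0 → d u (c (a u - 1)) ≤ η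

/-- The sum of the distances of a point to the far points. -/
noncomputable def farSum (d : ℕ → ℕ → ℝ) (n : ℕ) (a : ℕ → ℕ) (x : ℕ) : ℝ :=
  ∑ u ∈ cell n a 0, d u x

/-- The remote-clique value, without the constant contribution of the pairs of far points, of all
far points together with `x j` copies of the center `c j` for each `j < m`. -/
noncomputable def multVal (d : ℕ → ℕ → ℝ) (n : ℕ) (a c : ℕ → ℕ) (m : ℕ) (x : ℕ → ℕ) : ℝ :=
  ∑ i ∈ range m, (x i : ℝ) * ((∑ j ∈ range m, (x j : ℝ) * d (c i) (c j)) / 2 + farSum d n a (c i))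

/-- The multiplicities `x` can be realized by at most `k` points, the far points included. -/
def Feasible (n k : ℕ) (a : ℕ → ℕ) (m : ℕ) (x : ℕ → ℕ) : Prop :=
  (∀ i < m, x i ≤ (cell n a (i + 1)).card) ∧ ∑ i ∈ range m, x i + (cell n a 0).card ≤ k

/-- The point that represents `u`: itself if it is far, and the center of its cluster if not. -/
def rep (a c : ℕ → ℕ) (u : ℕ) : ℕ := if a u = 0 then u else c (a u - 1)

section

variable {z m k : ℕ} {ρ η : ℝ} {a c : ℕ → ℕ}

theorem Clustering.rep_lt (h : Clustering d n z ρ η a c m) {u : ℕ} (hu : u < n) :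
    rep a c u < n := by
  unfold rep
  split_ifs with h0
  · exact hu
  · exact h.center_lt _ (by have := h.label_le u hu; omega)

theorem Clustering.dist_rep (hd : IsPMetric d n) (hη : 0 ≤ η) (h : Clustering d n z ρ η a c m)
    {u : ℕ} (hu : u < n) : d u (rep a c u) ≤ η := by
  unfold rep
  split_ifs with h0
  · rwa [hd.self]
  · exact h.near u hu h0

/-- Replacing all points by their representatives changes each distance by at most `2 * η`. -/
theorem Clustering.abs_sub_le (hd : IsPMetric d n) (hη : 0 ≤ η) (h : Clustering d n z ρ η a c m)
    {S : Finset ℕ} (hS : S ⊆ range n) :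
    |(1 / 2) * ∑ u ∈ S, ∑ v ∈ S, d (rep a c u) (rep a c v) - cliqueVal d S| ≤
      η * (S.card : ℝ) ^ 2 := by
  have key : |∑ u ∈ S, ∑ v ∈ S, (d (rep a c u) (rep a c v) - d u v)| ≤
      ∑ u ∈ S, ∑ v ∈ S, 2 * η := by
    refine (abs_sum_le_sum_abs _ _).trans (sum_le_sum fun u hu => ?_)
    refine (abs_sum_le_sum_abs _ _).trans (sum_le_sum fun v hv => ?_)
    have hu' : u < n := by simpa using hS hu
    have hv' : v < n := by simpa using hS hv
    have hru := h.rep_lt hu'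
    have hrv := h.rep_lt hv'
    have h1 := h.dist_rep hd hη hu'
    have h2 := h.dist_rep hd hη hv'
    rw [abs_le]
    constructor <;>
    linarith [hd.tri u (rep a c u) v hru, hd.tri (rep a c u) (rep a c v) v hrv,
      hd.tri (rep a c u) u (rep a c v) hu', hd.tri u v (rep a c v) hv', hd.symm u (rep a c u),
      hd.symm v (rep a c v)]
  simp only [sum_const, nsmul_eq_mul, sum_sub_distrib] at key
  unfold cliqueVal
  rw [← mul_sub, abs_mul, abs_of_pos (by norm_num : (0 : ℝ) < 1 / 2)]
  linarith

theorem Clustering.sum_near (h : Clustering d n z ρ η a c m) {S : Finset ℕ} (hS : S ⊆ range n)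
    (f : ℕ → ℝ) : ∑ u ∈ S with a u ≠ 0, f (rep a c u) =
      ∑ i ∈ range m, ((S ∩ cell n a (i + 1)).card : ℝ) * f (c i) := by
  rw [← sum_fiberwise_of_maps_to (t := range m) (g := fun u => a u - 1)]
  · refine sum_congr rfl fun i _ => ?_
    have : ∀ u ∈ (S.filter (a · ≠ 0)).filter (a · - 1 = i), f (rep a c u) = f (c i) := by
      intro u hu
      simp only [mem_filter] at hu
      rw [rep, if_neg hu.1.2, hu.2]
    rw [sum_congr rfl this, sum_const, nsmul_eq_mul]
    congr 3
    ext u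
    simp only [mem_filter, mem_inter, mem_cell]
    constructor
    · rintro ⟨⟨h1, h2⟩, h3⟩
      exact ⟨h1, by simpa using hS h1, by omega⟩
    · rintro ⟨h1, h2, h3⟩
      exact ⟨⟨h1, by omega⟩, by omega⟩
  · intro u hu
    simp only [mem_filter, mem_range] at hu ⊢
    have := h.label_le u (by simpa using hS hu.1)
    omega

/-- Moving every near point to its center turns the remote-clique value into a function of the
numbers of points in the clusters. -/
theorem Clustering.sum_rep_eq (hd : IsPMetric d n) (h : Clustering d n z ρ η a c m) {S : Finset ℕ}
    (hS : S ⊆ range n) (hF : cell n a 0 ⊆ S) {x : ℕ → ℕ}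
    (hx : ∀ i < m, x i = (S ∩ cell n a (i + 1)).card) :
    (1 / 2) * ∑ u ∈ S, ∑ v ∈ S, d (rep a c u) (rep a c v) =
      cliqueVal d (cell n a 0) + multVal d n a c m x := by
  have hsplit : ∀ f : ℕ → ℝ, ∑ u ∈ S, f (rep a c u) =
      ∑ u ∈ cell n a 0, f u + ∑ i ∈ range m, (x i : ℝ) * f (c i) := by
    intro f
    rw [← sum_filter_add_sum_filter_not S (a · = 0), h.sum_near hS]
    congr 1
    · have : S.filter (a · = 0) = cell n a 0 := by
        ext u
        simp only [mem_filter, mem_cell]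
        exact ⟨fun hu => ⟨by simpa using hS hu.1, hu.2⟩,
          fun hu => ⟨hF (mem_cell.2 hu), hu.2⟩⟩
      rw [this]
      refine sum_congr rfl fun u hu => ?_
      rw [rep, if_pos (mem_cell.1 hu).2]
    · exact sum_congr rfl fun i hi => by rw [hx i (mem_range.1 hi)]
  have h1 : ∀ p, ∑ v ∈ S, d p (rep a c v) =
      ∑ v ∈ cell n a 0, d p v + ∑ j ∈ range m, (x j : ℝ) * d p (c j) := fun p => hsplit (d p)
  simp only [h1]
  rw [hsplit fun p => ∑ v ∈ cell n a 0, d p v + ∑ j ∈ range m, (x j : ℝ) * d p (c j)]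
  have h2 : ∑ u ∈ cell n a 0, ∑ j ∈ range m, (x j : ℝ) * d u (c j) =
      ∑ j ∈ range m, (x j : ℝ) * farSum d n a (c j) := by
    rw [sum_comm]
    exact sum_congr rfl fun j _ => by rw [farSum, mul_sum]
  have h3 : ∀ i, ∑ v ∈ cell n a 0, d (c i) v = farSum d n a (c i) := fun i =>
    sum_congr rfl fun v _ => hd.symm _ _
  simp only [sum_add_distrib, h2, h3, cliqueVal, multVal, mul_add, mul_div_assoc']
  rw [← sum_div]
  ring

/-- Rounding the multiplicities of a set down to multiples of `q`. -/
theorem Clustering.exists_rounded (h : Clustering d n z ρ η a c m) {T : Finset ℕ}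
    (hT : T ⊆ range n) (hF : cell n a 0 ⊆ T) {q : ℕ} (hq : 0 < q) :
    ∃ S ⊆ T, cell n a 0 ⊆ S ∧ (∀ i < m, q ∣ (S ∩ cell n a (i + 1)).card) ∧
      (T \ S).card ≤ m * (q - 1) := by
  have hR : ∀ j, ∃ R ⊆ T ∩ cell n a j, R.card = q * ((T ∩ cell n a j).card / q) := fun j =>
    exists_subset_card_eq (Nat.mul_div_le _ _)
  choose R hRs hRc using hR
  refine ⟨T.filter fun u => a u = 0 ∨ u ∈ R (a u), filter_subset _ _, ?_, ?_, ?_⟩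
  · exact fun u hu => mem_filter.2 ⟨hF hu, .inl (mem_cell.1 hu).2⟩
  · intro i _
    have : T.filter (fun u => a u = 0 ∨ u ∈ R (a u)) ∩ cell n a (i + 1) = R (i + 1) := by
      ext u
      simp only [mem_inter, mem_filter, mem_cell]
      constructor
      · rintro ⟨⟨_, h1⟩, _, h3⟩
        rw [h3] at h1
        exact h1.resolve_left (by omega)
      · intro hu
        have := hRs _ hu
        rw [mem_inter, mem_cell] at this
        exact ⟨⟨this.1, .inr (by rw [this.2.2]; exact hu)⟩, this.2⟩
    rw [this, hRc]
    exact Nat.dvd_mul_right _ _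
  · have hsub : T \ T.filter (fun u => a u = 0 ∨ u ∈ R (a u)) ⊆
        (range m).biUnion fun i => (T ∩ cell n a (i + 1)) \ R (i + 1) := by
      intro u hu
      simp only [mem_sdiff, mem_filter, not_and, not_or] at hu
      obtain ⟨huT, hu⟩ := hu
      have hun : u < n := by simpa using hT huT
      have h1 := hu huT
      refine mem_biUnion.2 ⟨a u - 1, ?_, ?_⟩
      · have := h.label_le u hun
        simp only [mem_range]
        omega
      · have h2 : a u - 1 + 1 = a u := by omega
        rw [h2, mem_sdiff, mem_inter, mem_cell]
        exact ⟨⟨huT, hun, rfl⟩, h1.2⟩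
    refine (card_le_card hsub).trans (card_biUnion_le.trans ?_)
    refine (sum_le_card_nsmul _ _ (q - 1) fun i _ => ?_).trans (by simp)
    rw [card_sdiff_of_subset (hRs _), hRc]
    have h1 := Nat.div_add_mod (T ∩ cell n a (i + 1)).card q
    have h2 := Nat.mod_lt (T ∩ cell n a (i + 1)).card hq
    omega

/-- The approximation guarantee: a set that contains all far points and realizes multiplicities
that are optimal among the multiples of `q` is nearly optimal. -/
theorem Clustering.approx (hd : IsPMetric d n) {V : Finset ℕ} {W ε : ℝ} {q : ℕ}
    (hw : FarWalk d n V z W) (hV : V.card = k) (hk : 2 ≤ k) (hε : 0 < ε) (hε1 : 128 * ε ≤ 1)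
    (h : Clustering d n z (25 * W / k) (ε * W / k) a c m) (hq : 0 < q)
    (hqm : (m : ℝ) * ((q : ℝ) - 1) ≤ ε * k) {best : ℕ → ℕ}
    (hbest : ∀ x, (∀ i < m, q ∣ x i) → Feasible n k a m x →
      multVal d n a c m x ≤ multVal d n a c m best)
    {S T : Finset ℕ} (hT : T ⊆ range n) (hTk : T.card = k) (hST : S ⊆ T) (hF : cell n a 0 ⊆ S)
    (hS : ∀ i < m, best i = (S ∩ cell n a (i + 1)).card)
    {T' : Finset ℕ} (hT' : T' ⊆ range n) (hT'k : T'.card = k) :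
    (1 - 128 * ε) * cliqueVal d T' ≤ cliqueVal d T := by
  have hk' : (2 : ℝ) ≤ k := by exact_mod_cast hk
  have hz : z < n := by simpa using hw.sub hw.mem
  have hW := hw.nonneg
  have hη : 0 ≤ ε * W / k := by positivity
  obtain ⟨O, hO, hmax⟩ := exists_max_image (powersetCard k (range n)) (cliqueVal d)
    ⟨T, mem_powersetCard.2 ⟨hT, hTk⟩⟩
  obtain ⟨hOn, hOk⟩ := mem_powersetCard.1 hO
  have hmax' : ∀ T' ⊆ range n, T'.card = k → cliqueVal d T' ≤ cliqueVal d O := fun T' h1 h2 =>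
    hmax T' (mem_powersetCard.2 ⟨h1, h2⟩)
  have hFO : cell n a 0 ⊆ O := fun u hu => by
    obtain ⟨hun, hu0⟩ := mem_cell.1 hu
    exact hw.mem_of_far hd hV hk hOn hOk hmax' hun ((h.far u hun).1 hu0)
  obtain ⟨R, hRO, hFR, hRq, hRc⟩ := h.exists_rounded hOn hFO hq
  have hRn := hRO.trans hOn
  -- dropping the points of `O \ R`, all of which are near, costs at most `30 * W` each
  have h1 : cliqueVal d O ≤ cliqueVal d R + (O \ R).card * (30 * W) := by
    refine hd.cliqueVal_le_of_subset hRO fun u hu => ?_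
    rw [mem_sdiff] at hu
    have hun : u < n := by simpa using hOn hu.1
    have hnear : d z u ≤ 25 * W / k := by
      by_contra! hcon
      exact hu.2 (hFR (mem_cell.2 ⟨hun, (h.far u hun).2 hcon⟩))
    calc ∑ w ∈ O, d u w ≤ ∑ w ∈ O, (25 * W / k + d w z) := sum_le_sum fun w _ => by
          linarith [hd.tri u z w hz, hd.symm u z, hd.symm z w]
      _ ≤ 30 * W := by
          rw [sum_add_distrib, sum_const, hOk, nsmul_eq_mul, mul_div_cancel₀ _ (by positivity)]
          linarith [hw.sum_le hd hV hk hOn hOk]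
  have h2 : ((O \ R).card : ℝ) * (30 * W) ≤ ε * k * (30 * W) := by
    refine mul_le_mul_of_nonneg_right (le_trans ?_ hqm) (by positivity)
    rw [← Nat.cast_one, ← Nat.cast_sub hq]
    exact_mod_cast hRc
  have hsq : ∀ U ⊆ range n, U.card ≤ k → ε * W / k * (U.card : ℝ) ^ 2 ≤ ε * k * W := by
    intro U _ hU
    have hU' : (U.card : ℝ) ^ 2 ≤ (k : ℝ) ^ 2 := by gcongr
    calc ε * W / k * (U.card : ℝ) ^ 2 ≤ ε * W / k * (k : ℝ) ^ 2 := by gcongr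
      _ = ε * k * W := by field_simp
  have h3 := (abs_le.1 (h.abs_sub_le hd hη hRn)).1
  have h4 := (abs_le.1 (h.abs_sub_le hd hη (hST.trans hT))).2
  have h5 := hsq R hRn ((card_le_card hRO).trans hOk.le)
  have h6 := hsq S (hST.trans hT) ((card_le_card hST).trans hTk.le)
  rw [h.sum_rep_eq hd hRn hFR (x := fun i => (R ∩ cell n a (i + 1)).card) fun _ _ => rfl] at h3
  rw [h.sum_rep_eq hd (hST.trans hT) hF hS] at h4
  have h7 := hbest (fun i => (R ∩ cell n a (i + 1)).card) hRq ⟨fun i _ =>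
    card_le_card inter_subset_right, by
      have hdisj : (↑(range m) : Set ℕ).PairwiseDisjoint fun i => R ∩ cell n a (i + 1) := by
        intro i _ j _ hij
        rw [Function.onFun, disjoint_left]
        intro u hu hu'
        have e1 := (mem_cell.1 (mem_inter.1 hu).2).2
        have e2 := (mem_cell.1 (mem_inter.1 hu').2).2
        omega
      rw [← card_biUnion hdisj, ← card_union_of_disjoint]
      · refine (card_le_card ?_).trans hOk.le
        refine union_subset (biUnion_subset.2 fun i _ => inter_subset_left.trans hRO) hFO
      · rw [disjoint_left]
        intro u hu hu'
        obtain ⟨i, _, hi⟩ := mem_biUnion.1 hu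
        have e1 := (mem_cell.1 (mem_inter.1 hi).2).2
        have e2 := (mem_cell.1 hu').2
        omega⟩
  have h8 := hd.cliqueVal_mono hST
  have h9 : k * W ≤ 4 * cliqueVal d O := by
    have := hw.mul_le_cliqueVal hd
    rw [hV] at this
    linarith [hmax' V hw.sub hV]
  have h10 : ε * k * W ≤ ε * (4 * cliqueVal d O) := by
    rw [mul_assoc]; gcongr
  have h11 : (1 - 128 * ε) * cliqueVal d T' ≤ (1 - 128 * ε) * cliqueVal d O :=
    mul_le_mul_of_nonneg_left (hmax' T' hT' hT'k) (by linarith)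
  linarith

end

end RealRAM

/-! ### Finding a central point -/

namespace RealRAM

open Finset

variable {d : ℕ → ℕ → ℝ} {n k : ℕ}

/-- Among the points `u` with `iarr 1 u = 0`, find one that is farthest from the point `ireg 4`;
it is returned in `ireg 5`, its distance in `rreg 2`. -/
def scanProg : Prog :=
  .seq (.rset 2 (.ofNat (.const 0)))
    (.forN 3 (.reg 0)
      (.ite (.conj (.ile (.get 1 (.reg 3)) (.const 0)) (.rle (.reg 2) (.dist (.reg 4) (.reg 3))))
        (.seq (.rset 2 (.dist (.reg 4) (.reg 3))) (.iset 5 (.reg 3))) .skip))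

theorem runs_scanProg (hd : IsPMetric d n) {s : State} {V : Finset ℕ} (h0 : s.ireg 0 = n)
    (hflag : ∀ u, s.iarr 1 u = if u ∈ V then 1 else 0) (hV : ∃ u < n, u ∉ V) :
    Runs d scanProg s (11 + n * 28) fun s' =>
      s'.ireg 5 < n ∧ s'.ireg 5 ∉ V ∧ s'.rreg 2 = d (s.ireg 4) (s'.ireg 5) ∧
      ∀ u < n, u ∉ V → d (s.ireg 4) u ≤ d (s.ireg 4) (s'.ireg 5) := by
  refine ((Runs.of_wp (Q := fun s' => s'.rreg 2 = 0) ?_).seq fun s₁ hs₁ h2 =>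
    (Runs.forN (N := n) (I := fun j s' => (∀ u < j, u ∉ V → d (s.ireg 4) u ≤ s'.rreg 2) ∧
      ((s'.rreg 2 = 0 ∧ ∀ u < j, u ∈ V) ∨
        (s'.ireg 5 < n ∧ s'.ireg 5 ∉ V ∧ s'.rreg 2 = d (s.ireg 4) (s'.ireg 5))))
      ?_ ?_ fun j s' hj hs' hI h3 => Runs.of_wp ?_)).mono ?_ ?_
  · simp [Prog.wp, RExpr.eval, IExpr.eval]
  · simp [h2]
  · intro i s' hs' _
    rw [IExpr.eval, hs'.i 0 (by decide), hs₁.i 0 (by decide), h0]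
  · have h4 : s'.ireg 4 = s.ireg 4 := by rw [hs'.i 4 (by decide), hs₁.i 4 (by decide)]
    have h1 : s'.iarr 1 = s.iarr 1 := by rw [hs'.ia 1 (by decide), hs₁.ia 1 (by decide)]
    obtain ⟨hI1, hI2⟩ := hI
    simp only [Prog.wp, BExpr.eval, RExpr.eval, IExpr.eval, h1, h3, h4, hflag]
    refine ⟨fun ⟨hb1, hb2⟩ => ?_, fun hb => ?_⟩
    · have hjV : j ∉ V := fun h => by simp [h] at hb1
      simp only [State.ireg_setIReg, State.rreg_setIReg, State.rreg_setRReg, State.ireg_setRReg]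
      refine ⟨by simp [h3], fun u hu huV => ?_, .inr (by simp [h3, hj, hjV])⟩
      rcases Nat.lt_succ_iff_lt_or_eq.1 hu with hu | rfl
      · simpa using (hI1 u hu huV).trans hb2
      · simp
    · have hjV : j ∉ V → d (s.ireg 4) j < s'.rreg 2 := fun h => by simpa [h] using hb
      simp only [State.ireg_setIReg, State.rreg_setIReg]
      refine ⟨trivial, fun u hu huV => ?_, ?_⟩
      · rcases Nat.lt_succ_iff_lt_or_eq.1 hu with hu | rfl
        · exact hI1 u hu huV
        · exact (hjV huV).le
      · rcases hI2 with ⟨h2, h⟩ | h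
        · refine .inl ⟨h2, fun u hu => ?_⟩
          rcases Nat.lt_succ_iff_lt_or_eq.1 hu with hu | rfl
          · exact h u hu
          · by_contra hcon
            linarith [hjV hcon, hd.nonneg (s.ireg 4) u]
        · exact .inr (by simpa using h)
  · simp [Prog.maxCost, IExpr.cost, RExpr.cost, BExpr.cost]; omega
  · rintro s' - ⟨hI1, hI2⟩
    obtain ⟨u, hu, huV⟩ := hV
    rcases hI2 with ⟨_, h⟩ | ⟨h1, h2, h3⟩
    · exact absurd (h u hu) huV
    · exact ⟨h1, h2, h3, fun v hv hvV => h3 ▸ hI1 v hv hvV⟩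

/-- The farthest-point walk with `k - 1` steps from the point `0`. The visited points are marked
in `iarr 1`; the last point is returned in `ireg 4`, the length of the walk in `rreg 1`. -/
def walkProg : Prog :=
  .seq (.istore 1 (.const 0) (.const 1))
    (.forN 2 (.sub (.reg 1) (.const 1))
      (.seq scanProg
        (.seq (.rset 1 (.add (.reg 1) (.reg 2)))
          (.seq (.istore 1 (.reg 5) (.const 1)) (.iset 4 (.reg 5))))))

theorem runs_walkProg (hd : IsPMetric d n) {s : State} (h0 : s.ireg 0 = n) (h1 : s.ireg 1 = k)
    (h4 : s.ireg 4 = 0) (hr1 : s.rreg 1 = 0) (hflag : ∀ u, s.iarr 1 u = 0) (hk : 0 < k)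
    (hkn : k ≤ n) :
    Runs d walkProg s (13 + k * (40 + n * 28)) fun s' =>
      ∃ V, FarWalk d n V (s'.ireg 4) (s'.rreg 1) ∧ V.card = k := by
  refine ((Runs.of_wp (Q := fun s' => ∀ u, s'.iarr 1 u = if u = 0 then 1 else 0) ?_).seq
    fun s₁ hs₁ hf₁ => (Runs.forN (N := k - 1) (I := fun i s' =>
      ∃ V, FarWalk d n V (s'.ireg 4) (s'.rreg 1) ∧ V.card = i + 1 ∧
        ∀ u, s'.iarr 1 u = if u ∈ V then 1 else 0)
      ?_ ?_ fun i s' hi hs' ⟨V, hV, hVc, hVf⟩ h2 =>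
        (runs_scanProg hd (V := V) ?_ hVf ?_).seq fun s₂ hs₂ ⟨hy, hyV, hr2, hfar⟩ =>
          Runs.of_wp ?_)).mono ?_ ?_
  · simp [Prog.wp, IExpr.eval, hflag]
  · refine ⟨{0}, ?_, by simp, by simpa using hf₁⟩
    simp only [State.ireg_setIReg, State.rreg_setIReg]
    rw [if_neg (by decide), hs₁.i 4 (by decide), hs₁.r 1 (by decide), h4, hr1]
    exact FarWalk.singleton hd (by omega)
  · intro i s' hs' _
    simp only [IExpr.eval]
    rw [hs'.i 1 (by decide), hs₁.i 1 (by decide), h1]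
  · rw [hs'.i 0 (by decide), hs₁.i 0 (by decide), h0]
  · by_contra! hcon
    have := card_le_card (s := range n) (t := V) fun u hu => hcon u (by simpa using hu)
    rw [card_range] at this
    omega
  · have h2' : s₂.ireg 2 = i := by rw [hs₂.i 2 (by decide), h2]
    have hr1' : s₂.rreg 1 = s'.rreg 1 := hs₂.r 1 (by decide)
    have hf' : s₂.iarr 1 = s'.iarr 1 := hs₂.ia 1 (by decide)
    simp only [Prog.wp, RExpr.eval, IExpr.eval, State.ireg_setIReg, State.rreg_setIReg,
      State.rreg_setRReg, State.ireg_setRReg, State.iarr_setIReg, State.iarr_setRReg,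
      State.iarr_setIArr, State.ireg_setIArr, State.rreg_setIArr]
    refine ⟨by simpa using h2', insert (s₂.ireg 5) V, ?_, ?_, ?_⟩
    · simpa [hr1', hr2] using hV.step hd hy hyV hfar
    · rw [card_insert_of_notMem hyV, hVc]
    · intro u
      simp only [true_and, mem_insert, hf', hVf]
      by_cases hu : u = s₂.ireg 5 <;> simp [hu]
  · simp only [Prog.maxCost, IExpr.cost, RExpr.cost]
    have : (k - 1) * (9 + (1 + 1 + 1) + (11 + n * 28 + (1 + (1 + 1 + 1) + (1 + 1 + 1 + (1 + 1)))))
      ≤ k * (40 + n * 28) := Nat.mul_le_mul (by omega) (by omega)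
    omega
  · rintro s' - ⟨V, hV, hVc, -⟩
    exact ⟨V, hV, by omega⟩

end RealRAM

/-! ### Clustering the near points -/

namespace RealRAM

open Finset

variable {d : ℕ → ℕ → ℝ} {n k : ℕ}

theorem card_cell_succ (a : ℕ → ℕ) (i j : ℕ) :
    (cell (i + 1) a j).card = (cell i a j).card + if a i = j then 1 else 0 := by
  unfold cell
  rw [range_add_one, filter_insert]
  split_ifs with h
  · rw [card_insert_of_notMem (by simp)]
  · rfl

theorem cell_congr {a a' : ℕ → ℕ} {i : ℕ} (h : ∀ u < i, a' u = a u) (j : ℕ) :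
    cell i a' j = cell i a j :=
  filter_congr fun u hu => by rw [h u (by simpa using hu)]

/-- The state of the greedy clustering after the points `0, …, i - 1`: there are `m` centers
`c 0, …, c (m - 1)`, more than `η` apart from each other and at most `ρ` away from `z`; the numbers
`size j` and `far` count the points of each cluster and the far points. -/
structure PartialNet (d : ℕ → ℕ → ℝ) (n z : ℕ) (ρ η : ℝ) (i : ℕ) (a c : ℕ → ℕ) (m : ℕ)
    (size : ℕ → ℕ) (far : ℕ) : Prop where
  center_lt : ∀ j < m, c j < n
  center_near : ∀ j < m, d z (c j) ≤ ρ
  sep : ∀ j < m, ∀ j' < j, η < d (c j) (c j')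
  label_le : ∀ u < i, a u ≤ m
  label_far : ∀ u < i, a u = 0 ↔ ρ < d z u
  label_near : ∀ u < i, a u ≠ 0 → d u (c (a u - 1)) ≤ η
  unlabelled : ∀ u, i ≤ u → a u = 0
  size_eq : ∀ j, size j = (cell i a (j + 1)).card
  far_eq : far = (cell i a 0).card

namespace PartialNet

variable {z i m far : ℕ} {ρ η : ℝ} {a c size : ℕ → ℕ}

theorem clustering (h : PartialNet d n z ρ η n a c m size far) : Clustering d n z ρ η a c m :=
  ⟨h.center_lt, h.label_le, h.label_far, h.label_near⟩

theorem add_far (h : PartialNet d n z ρ η i a c m size far) (hi : ρ < d z i) :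
    PartialNet d n z ρ η (i + 1) a c m size (far + 1) := by
  have hai : a i = 0 := h.unlabelled i le_rfl
  refine ⟨h.center_lt, h.center_near, h.sep, fun u hu => ?_, fun u hu => ?_, fun u hu => ?_,
    fun u hu => h.unlabelled u (by omega), fun j => ?_, ?_⟩
  · rcases Nat.lt_succ_iff_lt_or_eq.1 hu with hu | rfl
    · exact h.label_le u hu
    · omega
  · rcases Nat.lt_succ_iff_lt_or_eq.1 hu with hu | rfl
    · exact h.label_far u hu
    · simp [hai, hi]
  · rcases Nat.lt_succ_iff_lt_or_eq.1 hu with hu | rfl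
    · exact h.label_near u hu
    · exact fun h => absurd hai h
  · rw [card_cell_succ, hai, if_neg (by omega), h.size_eq, add_zero]
  · rw [card_cell_succ, if_pos hai, h.far_eq]

theorem add_center (h : PartialNet d n z ρ η i a c m size far) (hin : i < n) (hi : d z i ≤ ρ)
    (hsep : ∀ j < m, η < d i (c j)) {c' : ℕ → ℕ} (hc : ∀ j, c' j = if j = m then i else c j) :
    PartialNet d n z ρ η i a c' (m + 1) size far := by
  have hlt : ∀ j < m, c' j = c j := fun j hj => by rw [hc, if_neg hj.ne]
  have hm : c' m = i := by rw [hc, if_pos rfl]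
  refine ⟨fun j hj => ?_, fun j hj => ?_, fun j hj j' hj' => ?_,
    fun u hu => (h.label_le u hu).trans (by omega), h.label_far, fun u hu hu0 => ?_,
    h.unlabelled, h.size_eq, h.far_eq⟩
  · rcases Nat.lt_succ_iff_lt_or_eq.1 hj with hj | rfl
    · rw [hlt j hj]; exact h.center_lt j hj
    · rwa [hm]
  · rcases Nat.lt_succ_iff_lt_or_eq.1 hj with hj | rfl
    · rw [hlt j hj]; exact h.center_near j hj
    · rwa [hm]
  · rcases Nat.lt_succ_iff_lt_or_eq.1 hj with hj | rfl
    · rw [hlt j hj, hlt j' (by omega)]; exact h.sep j hj j' hj'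
    · rw [hm, hlt j' hj']; exact hsep j' hj'
  · have := h.label_le u hu
    rw [hlt _ (by omega)]
    exact h.label_near u hu hu0

theorem add_near (h : PartialNet d n z ρ η i a c m size far) (hi : d z i ≤ ρ) {j : ℕ} (hj : j < m)
    (hij : d i (c j) ≤ η) {a' size' : ℕ → ℕ} (ha : ∀ u, a' u = if u = i then j + 1 else a u)
    (hs : ∀ l, size' l = if l = j then size j + 1 else size l) :
    PartialNet d n z ρ η (i + 1) a' c m size' far := by
  have hlt : ∀ u < i, a' u = a u := fun u hu => by rw [ha, if_neg hu.ne]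
  have hai : a' i = j + 1 := by rw [ha, if_pos rfl]
  refine ⟨h.center_lt, h.center_near, h.sep, fun u hu => ?_, fun u hu => ?_, fun u hu => ?_,
    fun u hu => ?_, fun l => ?_, ?_⟩
  · rcases Nat.lt_succ_iff_lt_or_eq.1 hu with hu | rfl
    · rw [hlt u hu]; exact h.label_le u hu
    · omega
  · rcases Nat.lt_succ_iff_lt_or_eq.1 hu with hu | rfl
    · rw [hlt u hu]; exact h.label_far u hu
    · simp [hai, hi]
  · rcases Nat.lt_succ_iff_lt_or_eq.1 hu with hu | rfl
    · rw [hlt u hu]; exact h.label_near u hu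
    · simpa [hai] using hij
  · rw [ha, if_neg (by omega)]; exact h.unlabelled u (by omega)
  · rw [card_cell_succ, cell_congr hlt, hai, hs]
    by_cases hl : l = j
    · simp [hl, h.size_eq]
    · rw [if_neg hl, if_neg (by omega), h.size_eq, add_zero]
  · rw [card_cell_succ, cell_congr hlt, hai, if_neg (by omega), h.far_eq, add_zero]

/-- The centers form a separated set, whose size is controlled by the doubling dimension. -/
theorem exists_centers (hd : IsPMetric d n) (hη : 0 ≤ η)
    (h : PartialNet d n z ρ η i a c m size far) :
    ∃ C ⊆ range n, C.card = m ∧ (∀ x ∈ C, d z x ≤ ρ) ∧ ∀ x ∈ C, ∀ y ∈ C, x ≠ y → η < d x y := by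
  have hsep : ∀ j < m, ∀ j' < m, j ≠ j' → η < d (c j) (c j') := by
    intro j hj j' hj' hne
    rcases lt_or_gt_of_ne hne with hlt | hlt
    · rw [hd.symm]; exact h.sep j' hj' j hlt
    · exact h.sep j hj j' hlt
  refine ⟨(range m).image c, ?_, ?_, ?_, ?_⟩
  · intro x hx
    obtain ⟨j, hj, rfl⟩ := mem_image.1 hx
    simpa using h.center_lt j (by simpa using hj)
  · rw [card_image_of_injOn, card_range]
    intro j hj j' hj' hcc
    by_contra hne
    have := hsep j (by simpa using hj) j' (by simpa using hj') hne
    rw [show c j = c j' from hcc, hd.self] at this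
    linarith
  · intro x hx
    obtain ⟨j, hj, rfl⟩ := mem_image.1 hx
    exact h.center_near j (by simpa using hj)
  · intro x hx y hy hxy
    obtain ⟨j, hj, rfl⟩ := mem_image.1 hx
    obtain ⟨j', hj', rfl⟩ := mem_image.1 hy
    exact hsep j (by simpa using hj) j' (by simpa using hj') fun h => hxy (by rw [h])

end PartialNet

/-- Search for a center `iarr 2 j`, `j < ireg 6`, within distance `rreg 4` of the point `ireg 3`.
The index `j` is returned in `ireg 7`, or `ireg 6` if there is no such center. -/
def findProg : Prog :=
  .seq (.iset 7 (.reg 6))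
    (.forN 9 (.reg 6)
      (.ite (.rle (.dist (.reg 3) (.get 2 (.reg 9))) (.reg 4)) (.iset 7 (.reg 9)) .skip))

theorem runs_findProg {s : State} {M : ℕ} (hM : s.ireg 6 ≤ M) :
    Runs d findProg s (10 + M * 19) fun s' => s'.ireg 7 ≤ s.ireg 6 ∧
      (s'.ireg 7 < s.ireg 6 → d (s.ireg 3) (s.iarr 2 (s'.ireg 7)) ≤ s.rreg 4) ∧
      (s'.ireg 7 = s.ireg 6 → ∀ j < s.ireg 6, s.rreg 4 < d (s.ireg 3) (s.iarr 2 j)) := by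
  refine ((Runs.of_wp (Q := fun s' => s'.ireg 7 = s.ireg 6) ?_).seq fun s₁ hs₁ h7 =>
    (Runs.forN (N := s.ireg 6) (I := fun l s' =>
      (s'.ireg 7 = s.ireg 6 ∧ ∀ j < l, s.rreg 4 < d (s.ireg 3) (s.iarr 2 j)) ∨
      (s'.ireg 7 < s.ireg 6 ∧ d (s.ireg 3) (s.iarr 2 (s'.ireg 7)) ≤ s.rreg 4))
      ?_ ?_ fun l s' hl hs' hI h9 => Runs.of_wp ?_)).mono ?_ ?_
  · simp [Prog.wp, IExpr.eval]
  · simp [h7]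
  · intro i s' hs' _
    rw [IExpr.eval, hs'.i 6 (by decide), hs₁.i 6 (by decide)]
  · have h3 : s'.ireg 3 = s.ireg 3 := by rw [hs'.i 3 (by decide), hs₁.i 3 (by decide)]
    have h2 : s'.iarr 2 = s.iarr 2 := by rw [hs'.ia 2 (by decide), hs₁.ia 2 (by decide)]
    have h4 : s'.rreg 4 = s.rreg 4 := by rw [hs'.r 4 (by decide), hs₁.r 4 (by decide)]
    simp only [Prog.wp, BExpr.eval, RExpr.eval, IExpr.eval, h2, h3, h4, h9,
      State.ireg_setIReg]
    refine ⟨fun hb => ?_, fun hb => ?_⟩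
    · exact ⟨by simp, .inr (by simpa using ⟨hl, hb⟩)⟩
    · refine ⟨by trivial, ?_⟩
      rcases hI with ⟨hI1, hI2⟩ | hI
      · refine .inl ⟨by simpa using hI1, fun j hj => ?_⟩
        rcases Nat.lt_succ_iff_lt_or_eq.1 hj with hj | rfl
        · exact hI2 j hj
        · exact not_le.1 hb
      · exact .inr (by simpa using hI)
  · simp only [Prog.maxCost, IExpr.cost, RExpr.cost, BExpr.cost]
    have := Nat.mul_le_mul_right 19 hM
    simp only [max_eq_left (by norm_num : 1 ≤ 1 + 1)]
    omega
  · rintro s' - (⟨h1, h2⟩ | ⟨h1, h2⟩)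
    · exact ⟨h1.le, fun h => absurd h (by omega), fun _ => h2⟩
    · exact ⟨h1.le, fun _ => h2, fun h => absurd h (by omega)⟩

/-- The greedy clustering. The center is `z = ireg 4`, the scale is given by `rreg 1`; the radii
are computed in `rreg 3` and `rreg 4`. The labels are returned in `iarr 3`, the centers in
`iarr 2`, their number in `ireg 6`, the sizes of the clusters in `iarr 4`, the number of far points
in `ireg 8`. -/
def netProg : Prog :=
  .seq (.seq (.rset 3 (.div (.mul (.ofNat (.const 25)) (.reg 1)) (.ofNat (.reg 1))))
      (.rset 4 (.div (.mul (.reg 0) (.reg 1)) (.ofNat (.reg 1)))))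
    (.forN 3 (.reg 0)
      (.ite (.rle (.dist (.reg 4) (.reg 3)) (.reg 3))
        (.seq findProg
          (.seq (.ite (.ile (.reg 6) (.reg 7))
              (.seq (.istore 2 (.reg 6) (.reg 3)) (.iset 6 (.add (.reg 6) (.const 1)))) .skip)
            (.seq (.istore 3 (.reg 3) (.add (.reg 7) (.const 1)))
              (.istore 4 (.reg 7) (.add (.get 4 (.reg 7)) (.const 1))))))
        (.iset 8 (.add (.reg 8) (.const 1)))))

theorem runs_netProg (hd : IsPMetric d n) {s : State} {M : ℕ} {ρ η : ℝ} (h0 : s.ireg 0 = n)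
    (h6 : s.ireg 6 = 0) (h8 : s.ireg 8 = 0) (h3 : ∀ u, s.iarr 3 u = 0) (h4 : ∀ u, s.iarr 4 u = 0)
    (hρ : ρ = 25 * s.rreg 1 / s.ireg 1) (hη : η = s.rreg 0 * s.rreg 1 / s.ireg 1) (hη0 : 0 ≤ η)
    (hM : ∀ C ⊆ range n, (∀ x ∈ C, d (s.ireg 4) x ≤ ρ) →
      (∀ x ∈ C, ∀ y ∈ C, x ≠ y → η < d x y) → C.card ≤ M) :
    Runs d netProg s (25 + n * (65 + M * 19)) fun s' =>
      PartialNet d n (s.ireg 4) ρ η n (s'.iarr 3) (s'.iarr 2) (s'.ireg 6) (s'.iarr 4)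
        (s'.ireg 8) ∧ s'.ireg 6 ≤ M := by
  have hm : ∀ {i a c m size far}, PartialNet d n (s.ireg 4) ρ η i a c m size far → m ≤ M := by
    intro i a c m size far h
    obtain ⟨C, hC1, rfl, hC2, hC3⟩ := h.exists_centers hd hη0
    exact hM C hC1 hC2 hC3
  refine ((Runs.of_wp (Q := fun s' => s'.rreg 3 = ρ ∧ s'.rreg 4 = η) ?_).seq fun s₁ hs₁ hr =>
    (Runs.forN (N := n) (I := fun i s' => PartialNet d n (s.ireg 4) ρ η i (s'.iarr 3) (s'.iarr 2)
      (s'.ireg 6) (s'.iarr 4) (s'.ireg 8)) ?_ ?_ fun i s' hi hs' hI hx =>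
        Runs.ite (B := 48 + M * 19) (fun hb => ?_) (fun hb => ?_))).mono ?_ ?_
  · simp [Prog.wp, RExpr.eval, IExpr.eval, hρ, hη]
  · simp only [State.ireg_setIReg, State.iarr_setIReg]
    rw [if_neg (by decide), if_neg (by decide), hs₁.i 6 (by decide), hs₁.i 8 (by decide),
      hs₁.ia 2 (by decide), hs₁.ia 3 (by decide), hs₁.ia 4 (by decide), h6, h8]
    refine ⟨?_, ?_, ?_, ?_, ?_, ?_, ?_, ?_, ?_⟩ <;> simp [h3, h4, cell]
  · intro i s' hs' _
    rw [IExpr.eval, hs'.i 0 (by decide), hs₁.i 0 (by decide), h0]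
  · have e4 : s'.ireg 4 = s.ireg 4 := by rw [hs'.i 4 (by decide), hs₁.i 4 (by decide)]
    have r3 : s'.rreg 3 = ρ := by rw [hs'.r 3 (by decide), hr.1]
    have r4 : s'.rreg 4 = η := by rw [hs'.r 4 (by decide), hr.2]
    simp only [BExpr.eval, RExpr.eval, IExpr.eval, e4, r3, hx] at hb
    refine ((runs_findProg (hm hI)).seq fun s₂ hs₂ ⟨hj1, hj2, hj3⟩ => Runs.of_wp ?_).mono
      ?_ fun _ _ h => h
    · simp [Prog.maxCost, IExpr.cost, BExpr.cost]; omega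
    · rw [hx, r4] at hj2 hj3
      have f3 : s₂.ireg 3 = i := by rw [hs₂.i 3 (by decide), hx]
      simp only [← hs₂.i 6 (by decide), ← hs₂.i 8 (by decide), ← hs₂.ia 2 (by decide),
        ← hs₂.ia 3 (by decide), ← hs₂.ia 4 (by decide)] at hj1 hj2 hj3 hI
      simp only [Prog.wp, BExpr.eval, IExpr.eval, f3, State.ireg_setIReg,
        State.iarr_setIReg, State.ireg_setIArr, State.iarr_setIArr]
      refine ⟨fun hnew => ?_, fun hold => ?_⟩
      · have heq : s₂.ireg 7 = s₂.ireg 6 := le_antisymm hj1 hnew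
        have hc := hI.add_center hi hb (hj3 heq)
          (c' := fun j => if j = s₂.ireg 6 then i else s₂.iarr 2 j) fun _ => rfl
        refine ⟨by simp, ?_⟩
        simp only [heq]
        have := hc.add_near hb (j := s₂.ireg 6) (by omega) (by simpa [hd.self] using hη0)
          (a' := fun u => if u = i then s₂.ireg 6 + 1 else s₂.iarr 3 u)
          (size' := fun l => if l = s₂.ireg 6 then s₂.iarr 4 (s₂.ireg 6) + 1 else s₂.iarr 4 l)
          (fun _ => rfl) (fun _ => rfl)
        convert this using 1 <;> try (funext l) <;> simp
        all_goals simp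
      · have hlt : s₂.ireg 7 < s₂.ireg 6 := not_le.1 hold
        refine ⟨by simp, ?_⟩
        have := hI.add_near hb hlt (hj2 hlt)
          (a' := fun u => if u = i then s₂.ireg 7 + 1 else s₂.iarr 3 u)
          (size' := fun l => if l = s₂.ireg 7 then s₂.iarr 4 (s₂.ireg 7) + 1 else s₂.iarr 4 l)
          (fun _ => rfl) (fun _ => rfl)
        convert this using 1 <;> try (funext l) <;> simp
        all_goals simp
  · have e4 : s'.ireg 4 = s.ireg 4 := by rw [hs'.i 4 (by decide), hs₁.i 4 (by decide)]
    have r3 : s'.rreg 3 = ρ := by rw [hs'.r 3 (by decide), hr.1]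
    simp only [BExpr.eval, RExpr.eval, IExpr.eval, e4, r3, hx, not_le] at hb
    refine (Runs.of_wp ?_).mono (B₁ := 4) (by omega) fun _ _ h => h
    simp only [Prog.wp, IExpr.eval, State.ireg_setIReg, State.iarr_setIReg]
    exact ⟨by simpa using hx, by simpa using hI.add_far hb⟩
  · simp only [Prog.maxCost, IExpr.cost, RExpr.cost, BExpr.cost]
    have := Nat.mul_le_mul_left n (show 9 + 1 + (1 + (1 + (1 + 1 + 1) + 1) + (48 + M * 19)) ≤
      65 + M * 19 by omega)
    omega
  · exact fun s' _ h => ⟨h, hm h⟩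

end RealRAM

/-! ### Searching the multiplicities -/

namespace RealRAM

open Finset

variable {d : ℕ → ℕ → ℝ} {n k : ℕ}

theorem farSum_succ (a : ℕ → ℕ) (i x : ℕ) :
    farSum d (i + 1) a x = farSum d i a x + if a i = 0 then d i x else 0 := by
  unfold farSum cell
  rw [range_add_one, filter_insert]
  split_ifs with h
  · rw [sum_insert (by simp), add_comm]
  · rw [add_zero]

/-- For each center, the sum of its distances to the far points is stored in `rarr 0`. -/
def farSumProg : Prog :=
  .forN 9 (.reg 6)
    (.seq (.rset 5 (.ofNat (.const 0)))
      (.seq (.forN 3 (.reg 0)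
          (.ite (.ile (.get 3 (.reg 3)) (.const 0))
            (.rset 5 (.add (.reg 5) (.dist (.reg 3) (.get 2 (.reg 9))))) .skip))
        (.rstore 0 (.reg 9) (.reg 5))))

theorem runs_farSumProg {s : State} (h0 : s.ireg 0 = n) :
    Runs d farSumProg s (8 + s.ireg 6 * (30 + n * 30)) fun s' =>
      ∀ j < s.ireg 6, s'.rarr 0 j = farSum d n (s.iarr 3) (s.iarr 2 j) := by
  refine (Runs.forN (N := s.ireg 6) (I := fun i s' => ∀ j < i, s'.rarr 0 j =
    farSum d n (s.iarr 3) (s.iarr 2 j)) (by simp) ?_ fun i s' hi hs' hI hx => ?_).mono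
    (Nat.add_le_add le_rfl (Nat.mul_le_mul_left _
      (show 9 + 1 + (3 + ((7 + 1 + n * (9 + 1 + 12)) + 3)) ≤ 30 + n * 30 by omega)))
    fun _ _ h => h
  · intro i s' hs' _
    rw [IExpr.eval, hs'.i 6 (by decide)]
  · have e2 : s'.iarr 2 = s.iarr 2 := hs'.ia 2 (by decide)
    have e3 : s'.iarr 3 = s.iarr 3 := hs'.ia 3 (by decide)
    refine (Runs.of_wp (Q := fun s' => s'.rreg 5 = 0) (by
      simp [Prog.wp, RExpr.eval, IExpr.eval])).seq fun s₁ hs₁ h5 =>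
      (Runs.forN (N := n) (I := fun l s'' => s''.rreg 5 = farSum d l (s.iarr 3) (s.iarr 2 i))
        (by simp [h5, farSum, cell]) ?_ fun l s₂ hl hs₂ hI₂ hx₂ => Runs.of_wp ?_).seq
      fun s₃ hs₃ hI₃ => Runs.of_wp ?_
    · intro l s₂ hs₂ _
      rw [IExpr.eval, hs₂.i 0 (by decide), hs₁.i 0 (by decide), hs'.i 0 (by decide), h0]
    · have f2 : s₂.iarr 2 = s.iarr 2 := by rw [hs₂.ia 2 (by decide), hs₁.ia 2 (by decide), e2]
      have f3 : s₂.iarr 3 = s.iarr 3 := by rw [hs₂.ia 3 (by decide), hs₁.ia 3 (by decide), e3]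
      have f9 : s₂.ireg 9 = i := by rw [hs₂.i 9 (by decide), hs₁.i 9 (by decide), hx]
      simp only [Prog.wp, BExpr.eval, RExpr.eval, IExpr.eval, f2, f3, f9, hx₂, hI₂, farSum_succ]
      refine ⟨fun hb => ⟨by simpa using hx₂, ?_⟩, fun hb => ⟨trivial, ?_⟩⟩
      · simp [Nat.le_zero.1 hb]
      · rw [if_neg (by omega)]
        simpa using hI₂
    · have f9 : s₃.ireg 9 = i := by rw [hs₃.i 9 (by decide), hs₁.i 9 (by decide), hx]
      have g0 : s₃.rarr 0 = s'.rarr 0 := by rw [hs₃.ra 0 (by decide), hs₁.ra 0 (by decide)]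
      simp only [Prog.wp, RExpr.eval, IExpr.eval, f9, hI₃]
      refine ⟨by simpa using f9, fun j hj => ?_⟩
      rcases Nat.lt_succ_iff_lt_or_eq.1 hj with hj | rfl
      · simpa [hj.ne, g0] using hI j hj
      · simp

/-- The step width `q` of the multiplicities, the least positive integer with `ε * k < q * m`, is
computed in `ireg 10`. -/
def stepProg : Prog :=
  .seq (.iset 10 (.const 1))
    (.loop (.rle (.mul (.ofNat (.reg 10)) (.ofNat (.reg 6))) (.mul (.reg 0) (.ofNat (.reg 1))))
      (.iset 10 (.add (.reg 10) (.const 1))))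

theorem runs_stepProg {s : State} (hm : 0 < s.ireg 6) (hε : 0 ≤ s.rreg 0) (hε1 : s.rreg 0 ≤ 1) :
    Runs d stepProg s (14 + s.ireg 1 * 16) fun s' => 0 < s'.ireg 10 ∧
      (s.ireg 6 : ℝ) * ((s'.ireg 10 : ℝ) - 1) ≤ s.rreg 0 * s.ireg 1 ∧
      s.rreg 0 * s.ireg 1 < (s'.ireg 10 : ℝ) * s.ireg 6 := by
  have hm' : (1 : ℝ) ≤ s.ireg 6 := by exact_mod_cast hm
  have hex : ∃ i : ℕ, s.rreg 0 * s.ireg 1 < ((1 + i : ℕ) : ℝ) * s.ireg 6 := by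
    refine ⟨s.ireg 1, ?_⟩
    push_cast
    have : s.rreg 0 * s.ireg 1 ≤ 1 * s.ireg 1 := by gcongr
    nlinarith [(Nat.cast_nonneg (s.ireg 1) : (0 : ℝ) ≤ s.ireg 1)]
  classical
  set N := Nat.find hex with hN
  have hNspec := Nat.find_spec hex
  have hNmin : ∀ i < N, ((1 + i : ℕ) : ℝ) * s.ireg 6 ≤ s.rreg 0 * s.ireg 1 := fun i hi =>
    not_lt.1 (Nat.find_min hex hi)
  have hle : (s.ireg 6 : ℝ) * N ≤ s.rreg 0 * s.ireg 1 := by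
    rcases Nat.eq_zero_or_pos N with h | h
    · rw [h]; simp; positivity
    · have := hNmin (N - 1) (by omega)
      rw [show 1 + (N - 1) = N by omega] at this
      linarith
  have hNk : N ≤ s.ireg 1 := by
    have h1 : (N : ℝ) ≤ s.ireg 1 := by
      have : s.rreg 0 * s.ireg 1 ≤ 1 * s.ireg 1 := by gcongr
      nlinarith [(Nat.cast_nonneg N : (0 : ℝ) ≤ N)]
    exact_mod_cast h1
  refine ((Runs.of_wp (Q := fun s' => s'.ireg 10 = 1) (by simp [Prog.wp, IExpr.eval])).seq
    fun s₁ hs₁ h10 => Runs.loop (N := N) (I := fun i s' => s'.ireg 10 = 1 + i)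
      (by simpa using h10) (fun i s' hi hs' hI => ⟨?_, Runs.of_wp ?_⟩) fun s' hs' hI => ?_).mono
      ?_ fun s' _ hI => ?_
  · simp only [BExpr.eval, RExpr.eval, IExpr.eval]
    rw [hI, hs'.i 6 (by decide), hs'.i 1 (by decide), hs'.r 0 (by decide), hs₁.i 6 (by decide),
      hs₁.i 1 (by decide), hs₁.r 0 (by decide)]
    exact hNmin i hi
  · simp only [Prog.wp, IExpr.eval, hI]
    simp only [State.ireg_setIReg, if_true]
    omega
  · simp only [BExpr.eval, RExpr.eval, IExpr.eval]
    rw [hI, hs'.i 6 (by decide), hs'.i 1 (by decide), hs'.r 0 (by decide), hs₁.i 6 (by decide),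
      hs₁.i 1 (by decide), hs₁.r 0 (by decide)]
    exact not_le.2 hNspec
  · simp only [Prog.maxCost, IExpr.cost, RExpr.cost, BExpr.cost]
    have := Nat.mul_le_mul_right 16 hNk
    omega
  · rw [hI]
    refine ⟨by omega, ?_, hNspec⟩
    push_cast
    linarith

theorem multVal_congr {a c : ℕ → ℕ} {m : ℕ} {x y : ℕ → ℕ} (h : ∀ i < m, x i = y i) :
    multVal d n a c m x = multVal d n a c m y := by
  have : ∀ f : ℕ → ℝ, ∑ j ∈ range m, (x j : ℝ) * f j = ∑ j ∈ range m, (y j : ℝ) * f j := fun f =>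
    sum_congr rfl fun j hj => by rw [h j (mem_range.1 hj)]
  unfold multVal
  simp only [this]

theorem Feasible.congr {a : ℕ → ℕ} {m : ℕ} {x y : ℕ → ℕ} (hx : Feasible n k a m x)
    (h : ∀ i < m, x i = y i) : Feasible n k a m y := by
  refine ⟨fun i hi => h i hi ▸ hx.1 i hi, ?_⟩
  rw [← sum_congr rfl fun i hi => h i (mem_range.1 hi)]
  exact hx.2

/-- The value of the multiplicities in `iarr 5` is computed in `rreg 7` and their sum in `ireg 12`;
`ireg 13` becomes `1` if one of them exceeds the size of its cluster. -/
def evalProg : Prog :=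
  .seq (.seq (.rset 7 (.ofNat (.const 0))) (.seq (.iset 12 (.const 0)) (.iset 13 (.const 0))))
    (.forN 2 (.reg 6)
      (.seq (.seq (.iset 12 (.add (.reg 12) (.get 5 (.reg 2))))
          (.seq (.ite (.ile (.get 5 (.reg 2)) (.get 4 (.reg 2))) .skip (.iset 13 (.const 1)))
            (.rset 8 (.ofNat (.const 0)))))
        (.seq (.forN 9 (.reg 6) (.rset 8 (.add (.reg 8)
            (.mul (.ofNat (.get 5 (.reg 9))) (.dist (.get 2 (.reg 2)) (.get 2 (.reg 9)))))))
          (.rset 7 (.add (.reg 7) (.mul (.ofNat (.get 5 (.reg 2)))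
            (.add (.div (.reg 8) (.ofNat (.const 2))) (.get 0 (.reg 2)))))))))

theorem runs_evalProg {s : State} {a : ℕ → ℕ} {m : ℕ} (h6 : s.ireg 6 = m)
    (hr : ∀ j < m, s.rarr 0 j = farSum d n a (s.iarr 2 j)) :
    Runs d evalProg s (20 + m * (60 + m * 22)) fun s' =>
      s'.rreg 7 = multVal d n a (s.iarr 2) m (s.iarr 5) ∧
      s'.ireg 12 = ∑ i ∈ range m, s.iarr 5 i ∧
      (s'.ireg 13 ≤ 0 ↔ ∀ i < m, s.iarr 5 i ≤ s.iarr 4 i) := by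
  refine ((Runs.of_wp (Q := fun s' => s'.rreg 7 = 0 ∧ s'.ireg 12 = 0 ∧ s'.ireg 13 = 0)
    (by simp [Prog.wp, RExpr.eval, IExpr.eval])).seq fun s₁ hs₁ h₁ =>
    Runs.forN (N := m) (I := fun i s' =>
      s'.rreg 7 = ∑ i ∈ range i, (s.iarr 5 i : ℝ) * ((∑ j ∈ range m,
        (s.iarr 5 j : ℝ) * d (s.iarr 2 i) (s.iarr 2 j)) / 2 + farSum d n a (s.iarr 2 i)) ∧
      s'.ireg 12 = ∑ i ∈ range i, s.iarr 5 i ∧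
      (s'.ireg 13 ≤ 0 ↔ ∀ j < i, s.iarr 5 j ≤ s.iarr 4 j)) (by simp [h₁]) ?_
    fun i s' hi hs' hI hx => (Runs.of_wp (Q := fun s'' => s''.ireg 2 = i ∧ s''.rreg 8 = 0 ∧
      s''.ireg 12 = ∑ i ∈ range (i + 1), s.iarr 5 i ∧
      (s''.ireg 13 ≤ 0 ↔ ∀ j < i + 1, s.iarr 5 j ≤ s.iarr 4 j)) ?_).seq fun s₂ hs₂ h₂ =>
      (Runs.forN (N := m) (I := fun l s'' => s''.rreg 8 = ∑ j ∈ range l,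
        (s.iarr 5 j : ℝ) * d (s.iarr 2 i) (s.iarr 2 j)) ?_ ?_ fun l s₃ hl hs₃ hI₃ hx₃ =>
          Runs.of_wp ?_).seq fun s₃ hs₃ hI₃ => Runs.of_wp ?_).mono ?_ fun _ _ h => h
  · intro i s' hs' _
    rw [IExpr.eval, hs'.i 6 (by decide), hs₁.i 6 (by decide), h6]
  · have e5 : s'.iarr 5 = s.iarr 5 := by rw [hs'.ia 5 (by decide), hs₁.ia 5 (by decide)]
    have e4 : s'.iarr 4 = s.iarr 4 := by rw [hs'.ia 4 (by decide), hs₁.ia 4 (by decide)]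
    have hsucc : (∀ j < i + 1, s.iarr 5 j ≤ s.iarr 4 j) ↔
        (∀ j < i, s.iarr 5 j ≤ s.iarr 4 j) ∧ s.iarr 5 i ≤ s.iarr 4 i := by
      simp only [Nat.lt_succ_iff_lt_or_eq, or_imp, forall_and, forall_eq]
    simp only [Prog.wp, BExpr.eval, RExpr.eval, IExpr.eval, hx, e4, e5, State.ireg_setIReg,
      State.iarr_setIReg, State.ireg_setRReg, State.rreg_setRReg, sum_range_succ, hsucc,
      Nat.reduceEqDiff, reduceIte]
    refine ⟨fun hb => ?_, fun hb => ?_⟩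
    · simp only [hb, and_true]
      simpa [hx, hI.2.1] using hI.2.2
    · simp only [hb, and_false]
      simp [hI.2.1]
  · simpa using h₂.2.1
  · intro l s₃ hs₃ _
    rw [IExpr.eval, hs₃.i 6 (by decide), hs₂.i 6 (by decide), hs'.i 6 (by decide),
      hs₁.i 6 (by decide), h6]
  · have f5 : s₃.iarr 5 = s.iarr 5 := by
      rw [hs₃.ia 5 (by decide), hs₂.ia 5 (by decide), hs'.ia 5 (by decide), hs₁.ia 5 (by decide)]
    have f2 : s₃.iarr 2 = s.iarr 2 := by
      rw [hs₃.ia 2 (by decide), hs₂.ia 2 (by decide), hs'.ia 2 (by decide), hs₁.ia 2 (by decide)]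
    have g2 : s₃.ireg 2 = i := by rw [hs₃.i 2 (by decide), h₂.1]
    simp only [Prog.wp, RExpr.eval, IExpr.eval, f5, f2, g2, hx₃, hI₃, State.ireg_setRReg,
      State.rreg_setIReg, State.rreg_setRReg, sum_range_succ]
    simp
  · have f5 : s₃.iarr 5 = s.iarr 5 := by
      rw [hs₃.ia 5 (by decide), hs₂.ia 5 (by decide), hs'.ia 5 (by decide), hs₁.ia 5 (by decide)]
    have f0 : s₃.rarr 0 = s.rarr 0 := by
      rw [hs₃.ra 0 (by decide), hs₂.ra 0 (by decide), hs'.ra 0 (by decide), hs₁.ra 0 (by decide)]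
    have g2 : s₃.ireg 2 = i := by rw [hs₃.i 2 (by decide), h₂.1]
    have g7 : s₃.rreg 7 = s'.rreg 7 := by rw [hs₃.r 7 (by decide), hs₂.r 7 (by decide)]
    have g12 : s₃.ireg 12 = s₂.ireg 12 := hs₃.i 12 (by decide)
    have g13 : s₃.ireg 13 = s₂.ireg 13 := hs₃.i 13 (by decide)
    simp only [Prog.wp, RExpr.eval, IExpr.eval, f5, f0, g2, g7, hI₃, hI.1, hr i hi,
      State.ireg_setIReg, State.ireg_setRReg, State.rreg_setIReg, State.rreg_setRReg]
    refine ⟨trivial, ?_, ?_, ?_⟩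
    · rw [sum_range_succ _ i]; simp
    · simpa [g12] using h₂.2.2.1
    · simpa [g13] using h₂.2.2.2
  · simp only [Prog.maxCost, IExpr.cost, RExpr.cost, BExpr.cost]
    refine le_trans (Nat.add_le_add (Nat.le_refl _) (Nat.add_le_add (Nat.le_refl _)
      (Nat.mul_le_mul_left m (m := 60 + m * 22) ?_))) ?_ <;> omega

/-- If the multiplicities in `iarr 5` are feasible and at least as good as the best ones so far,
which are kept in `iarr 6` and have the value `rreg 6`, they become the best ones. -/
def updateProg : Prog :=
  .ite (.conj (.conj (.ile (.reg 13) (.const 0)) (.ile (.add (.reg 12) (.reg 8)) (.reg 1)))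
      (.rle (.reg 6) (.reg 7)))
    (.seq (.rset 6 (.reg 7)) (.forN 2 (.reg 6) (.istore 6 (.reg 2) (.get 5 (.reg 2))))) .skip

theorem runs_updateProg {s : State} {m : ℕ} (h6 : s.ireg 6 = m) :
    Runs d updateProg s (30 + m * 20) fun s' =>
      ((s.ireg 13 ≤ 0 ∧ s.ireg 12 + s.ireg 8 ≤ s.ireg 1) ∧ s.rreg 6 ≤ s.rreg 7 ∧
        s'.rreg 6 = s.rreg 7 ∧ ∀ i < m, s'.iarr 6 i = s.iarr 5 i) ∨
      (((s.ireg 13 ≤ 0 ∧ s.ireg 12 + s.ireg 8 ≤ s.ireg 1) → s.rreg 7 ≤ s.rreg 6) ∧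
        s'.rreg 6 = s.rreg 6 ∧ s'.iarr 6 = s.iarr 6) := by
  refine (Runs.ite (B := 10 + m * 14) (fun hb => ?_) fun hb => ?_).mono
    (by simp only [IExpr.cost, RExpr.cost, BExpr.cost]; omega) fun _ _ h => h
  · refine ((Runs.of_wp (Q := fun s' => s'.rreg 6 = s.rreg 7)
      (by simp [Prog.wp, RExpr.eval])).seq fun s₁ hs₁ h₁ =>
      Runs.forN (N := m) (I := fun i s' => s'.rreg 6 = s.rreg 7 ∧
          ∀ j < i, s'.iarr 6 j = s.iarr 5 j) (by simp [h₁]) ?_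
        fun i s' hi hs' ⟨hr, hI⟩ hx => Runs.of_wp ?_).mono ?_ fun s' hs' hI => ?_
    · intro i s' hs' _
      rw [IExpr.eval, hs'.i 6 (by decide), hs₁.i 6 (by decide), h6]
    · have e5 : s'.iarr 5 = s.iarr 5 := by rw [hs'.ia 5 (by decide), hs₁.ia 5 (by decide)]
      simp only [Prog.wp, IExpr.eval, hx, e5]
      refine ⟨by simpa using hx, hr, fun j hj => ?_⟩
      rcases Nat.lt_succ_iff_lt_or_eq.1 hj with hj | rfl
      · simpa [hj.ne] using hI j hj
      · simp
    · simp only [Prog.maxCost, IExpr.cost, RExpr.cost]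
      omega
    · simp only [BExpr.eval, RExpr.eval, IExpr.eval] at hb
      exact .inl ⟨hb.1, hb.2, hI⟩
  · simp only [BExpr.eval, RExpr.eval, IExpr.eval] at hb
    refine (Runs.of_wp ?_).mono (B₁ := 1) (by omega) fun _ _ h => h
    simp only [Prog.wp]
    exact .inr ⟨fun h => le_of_not_ge fun h' => hb ⟨h, h'⟩, trivial, trivial⟩

/-- The `l`-th digit of the next number. -/
theorem digit_succ {L : ℕ} (hL : 0 < L) (t l : ℕ) :
    ((t + 1) / L ^ l % L =
      if L ^ l ∣ t + 1 then if t / L ^ l % L + 1 < L then t / L ^ l % L + 1 else 0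
      else t / L ^ l % L) ∧
    (L ^ (l + 1) ∣ t + 1 ↔ L ^ l ∣ t + 1 ∧ ¬ t / L ^ l % L + 1 < L) := by
  have hlt := Nat.mod_lt (t / L ^ l) hL
  have hpos : 0 < L ^ l := Nat.pow_pos hL
  by_cases h : L ^ l ∣ t + 1
  · have h1 : (t + 1) / L ^ l = t / L ^ l + 1 := by rw [Nat.succ_div, if_pos h]
    have h2 : L ^ (l + 1) ∣ t + 1 ↔ L ∣ t / L ^ l + 1 := by
      rw [← h1, pow_succ, Nat.dvd_div_iff_mul_dvd h]
    have h3 : (t / L ^ l + 1) % L =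
        if t / L ^ l % L + 1 < L then t / L ^ l % L + 1 else 0 := by
      rw [← Nat.mod_add_mod]
      split_ifs with hlt'
      · exact Nat.mod_eq_of_lt hlt'
      · rw [show t / L ^ l % L + 1 = L by omega, Nat.mod_self]
    rw [if_pos h, h1, h2, Nat.dvd_iff_mod_eq_zero, h3]
    refine ⟨rfl, ?_⟩
    split_ifs with hlt' <;> simp [h, hlt']
  · have h1 : (t + 1) / L ^ l = t / L ^ l := by rw [Nat.succ_div, if_neg h, add_zero]
    refine ⟨by rw [if_neg h, h1], ?_⟩
    simp only [h, false_and, iff_false]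
    exact fun h' => h ((pow_dvd_pow L (Nat.le_succ l)).trans h')

/-- The multiplicities that are examined in round `t`: the digits of `t` in base `k / q + 1`,
multiplied by `q`. -/
def multVec (k q t : ℕ) (j : ℕ) : ℕ := q * (t / (k / q + 1) ^ j % (k / q + 1))

/-- Every vector of multiples of `q` up to `k` is examined in some round. -/
theorem exists_multVec {q m : ℕ} {x : ℕ → ℕ} (hx : ∀ i < m, q ∣ x i)
    (hxk : ∀ i < m, x i ≤ k) :
    ∃ t < (k / q + 1) ^ m, ∀ i < m, multVec k q t i = x i := by
  let f : Fin m → Fin (k / q + 1) := fun i =>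
    ⟨x i / q, Nat.lt_succ_of_le (Nat.div_le_div_right (hxk i i.2))⟩
  refine ⟨finFunctionFinEquiv f, (finFunctionFinEquiv f).2, fun i hi => ?_⟩
  have h1 : (finFunctionFinEquiv.symm (finFunctionFinEquiv f) ⟨i, hi⟩ : ℕ) = x i / q := by
    rw [Equiv.symm_apply_apply]
  have h2 : (finFunctionFinEquiv.symm (finFunctionFinEquiv f) ⟨i, hi⟩ : ℕ) =
    (finFunctionFinEquiv f : ℕ) / (k / q + 1) ^ i % (k / q + 1) := rfl
  rw [multVec, ← h2, h1, Nat.mul_div_cancel' (hx i hi)]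

/-- The multiplicities in `iarr 5` are advanced like an odometer; `ireg 11` is the carry. -/
def nextProg : Prog :=
  .seq (.iset 11 (.const 1))
    (.forN 2 (.reg 6)
      (.ite (.ile (.const 1) (.reg 11))
        (.ite (.ile (.add (.get 5 (.reg 2)) (.reg 10)) (.reg 1))
          (.seq (.istore 5 (.reg 2) (.add (.get 5 (.reg 2)) (.reg 10))) (.iset 11 (.const 0)))
          (.istore 5 (.reg 2) (.const 0)))
        .skip))

theorem runs_nextProg {s : State} {m q t : ℕ} (hq : 0 < q) (h1 : s.ireg 1 = k) (h6 : s.ireg 6 = m)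
    (h10 : s.ireg 10 = q) (h5 : ∀ j < m, s.iarr 5 j = multVec k q t j) :
    Runs d nextProg s (12 + m * 40) fun s' => (∀ j < m, s'.iarr 5 j = multVec k q (t + 1) j) ∧
      s'.ireg 11 = if (k / q + 1) ^ m ∣ t + 1 then 1 else 0 := by
  refine ((Runs.of_wp (Q := fun s' => s'.ireg 11 = 1) (by simp [Prog.wp, IExpr.eval])).seq
    fun s₁ hs₁ h11 => Runs.forN (N := m) (I := fun l s' =>
      (∀ j < m, s'.iarr 5 j = if j < l then multVec k q (t + 1) j else multVec k q t j) ∧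
      s'.ireg 11 = if (k / q + 1) ^ l ∣ t + 1 then 1 else 0) ?_ ?_
      fun l s' hl hs' ⟨hI1, hI2⟩ hx => Runs.of_wp ?_).mono ?_ fun s' hs' ⟨hI1, hI2⟩ => ?_
  · refine ⟨fun j hj => ?_, by simp [h11]⟩
    simp only [State.iarr_setIReg, not_lt_zero, if_false]
    rw [hs₁.ia 5 (by decide), h5 j hj]
  · intro i s' hs' _
    rw [IExpr.eval, hs'.i 6 (by decide), hs₁.i 6 (by decide), h6]
  · have e1 : s'.ireg 1 = k := by rw [hs'.i 1 (by decide), hs₁.i 1 (by decide), h1]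
    have e10 : s'.ireg 10 = q := by rw [hs'.i 10 (by decide), hs₁.i 10 (by decide), h10]
    have hl5 := hI1 l hl
    rw [if_neg (lt_irrefl l)] at hl5
    obtain ⟨hdig, hcarry⟩ := digit_succ (Nat.succ_pos (k / q)) t l
    have hle : multVec k q t l + q ≤ k ↔ t / (k / q + 1) ^ l % (k / q + 1) + 1 < k / q + 1 := by
      rw [multVec, ← Nat.mul_succ, Nat.succ_lt_succ_iff, Nat.lt_iff_add_one_le,
        Nat.le_div_iff_mul_le hq, mul_comm]
    have hstep : ∀ (g : ℕ → ℕ), g l = multVec k q (t + 1) l →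
        (∀ j, j ≠ l → g j = s'.iarr 5 j) → ∀ j < m, g j =
          if j < l + 1 then multVec k q (t + 1) j else multVec k q t j := by
      intro g hg hne j hj
      rcases lt_trichotomy j l with h | rfl | h
      · rw [hne j h.ne, hI1 j hj, if_pos h, if_pos (by omega)]
      · rw [hg, if_pos (by omega)]
      · rw [hne j h.ne', hI1 j hj, if_neg (by omega), if_neg (by omega)]
    simp only [Prog.wp, BExpr.eval, IExpr.eval, hx, e1, e10, hl5, hI2, hle]
    refine ⟨fun hb => ⟨fun hb' => ?_, fun hb' => ?_⟩, fun hb => ?_⟩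
    · have hdvd : (k / q + 1) ^ l ∣ t + 1 := by by_contra h; simp [h] at hb
      rw [if_pos hdvd, if_pos hb'] at hdig
      refine ⟨by simpa using hx, hstep _ ?_ ?_, ?_⟩
      · simp [multVec, hdig, mul_add]
      · intro j hj; simp [hj]
      · simp [hcarry, hb']
    · have hdvd : (k / q + 1) ^ l ∣ t + 1 := by by_contra h; simp [h] at hb
      rw [if_pos hdvd, if_neg hb'] at hdig
      refine ⟨by simpa using hx, hstep _ ?_ ?_, ?_⟩
      · simp [multVec, hdig]
      · intro j hj; simp [hj]
      · rw [if_pos (hcarry.2 ⟨hdvd, hb'⟩)]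
        simp [hI2, hdvd]
    · have hdvd : ¬ (k / q + 1) ^ l ∣ t + 1 := by intro h; simp [h] at hb
      rw [if_neg hdvd] at hdig
      refine ⟨trivial, hstep _ ?_ fun _ _ => rfl, ?_⟩
      · simp only [State.iarr_setIReg]
        rw [hl5, multVec, multVec, hdig]
      · rw [if_neg fun h => hdvd (hcarry.1 h).1]
        simp [hI2, hdvd]
  · simp only [Prog.maxCost, IExpr.cost, BExpr.cost]
    refine le_trans (Nat.add_le_add (Nat.le_refl _) (Nat.add_le_add (Nat.le_refl _)
      (Nat.mul_le_mul_left m (m := 40) ?_))) ?_ <;> omega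
  · exact ⟨fun j hj => by rw [hI1 j hj, if_pos hj], hI2⟩

/-- All vectors of multiples of `ireg 10` up to `k` are examined; the best feasible one ends up in
`iarr 6`. -/
def searchProg : Prog :=
  .loop (.ile (.reg 11) (.const 0)) (.seq evalProg (.seq updateProg nextProg))

theorem runs_searchProg {s : State} {a c : ℕ → ℕ} {m q : ℕ} (h1 : s.ireg 1 = k)
    (h6 : s.ireg 6 = m) (h10 : s.ireg 10 = q) (hq : 0 < q) (h11 : s.ireg 11 = 0)
    (h8 : s.ireg 8 = (cell n a 0).card) (h4 : ∀ j, s.iarr 4 j = (cell n a (j + 1)).card)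
    (hc : s.iarr 2 = c) (hr : ∀ j < m, s.rarr 0 j = farSum d n a (c j))
    (h5 : ∀ j, s.iarr 5 j = 0) (h60 : ∀ j, s.iarr 6 j = 0) (hr6 : s.rreg 6 = 0)
    (hfar : (cell n a 0).card ≤ k) :
    Runs d searchProg s (4 + (k / q + 1) ^ m * (70 + m * (120 + m * 22))) fun s' =>
      Feasible n k a m (s'.iarr 6) ∧ ∀ x, (∀ i < m, q ∣ x i) → Feasible n k a m x →
        multVal d n a c m x ≤ multVal d n a c m (s'.iarr 6) := by
  have hpos : 0 < (k / q + 1) ^ m := Nat.pow_pos (Nat.succ_pos _)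
  refine (Runs.loop (N := (k / q + 1) ^ m) (I := fun t s' =>
    t ≤ (k / q + 1) ^ m ∧ (∀ j < m, s'.iarr 5 j = multVec k q t j) ∧
    s'.ireg 11 = (if t = (k / q + 1) ^ m then 1 else 0) ∧ Feasible n k a m (s'.iarr 6) ∧
    s'.rreg 6 = multVal d n a c m (s'.iarr 6) ∧
    ∀ t' < t, Feasible n k a m (multVec k q t') → multVal d n a c m (multVec k q t') ≤ s'.rreg 6)
    ?_ (fun t s' ht hs' ⟨_, hI5, hI11, hIf, hIr, hIb⟩ => ⟨?_,
      (runs_evalProg (n := n) (a := a) (m := m) ?_ ?_).seq fun s₁ hs₁ ⟨hv, hsum, hsize⟩ =>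
      (runs_updateProg (m := m) ?_).seq fun s₂ hs₂ hupd =>
      (runs_nextProg (k := k) (m := m) (q := q) (t := t) hq ?_ ?_ ?_ ?_).mono le_rfl
        fun s₃ hs₃ ⟨hn5, hn11⟩ => ?_⟩) ?_).mono ?_ ?_
  · refine ⟨by omega, fun j _ => by simp [h5, multVec], ?_, ?_, ?_, by simp⟩
    · rw [if_neg hpos.ne, h11]
    · exact ⟨fun i _ => by simp [h60], by simpa [h60] using hfar⟩
    · simp [hr6, multVal, h60]
  · simp only [BExpr.eval, IExpr.eval, hI11, if_neg ht.ne, le_refl]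
  · rw [hs'.i 6 (by decide), h6]
  · intro j hj
    rw [hs'.ra 0 (by decide), hs'.ia 2 (by decide), hc, hr j hj]
  · rintro s' - ⟨_, _, hI, _⟩
    simp [BExpr.eval, IExpr.eval, hI]
  · simp only [IExpr.cost, BExpr.cost]
    refine Nat.add_le_add (by norm_num) (Nat.mul_le_mul_left _ ?_)
    have : m * (120 + m * 22) = m * (60 + m * 22) + m * 20 + m * 40 := by ring
    omega
  · rintro s' - ⟨_, _, _, hf, hr', hb⟩
    refine ⟨hf, fun x hxq hx => ?_⟩
    have hxk : ∀ i < m, x i ≤ k := fun i hi =>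
      (single_le_sum (f := x) (fun _ _ => Nat.zero_le _) (mem_range.2 hi)).trans
        ((Nat.le_add_right _ _).trans hx.2)
    obtain ⟨t, ht, htx⟩ := exists_multVec hxq hxk
    rw [← hr', ← multVal_congr htx]
    exact hb t ht (hx.congr fun i hi => (htx i hi).symm)
  · rw [hs₁.i 6 (by decide), hs'.i 6 (by decide), h6]
  · rw [hs₂.i 1 (by decide), hs₁.i 1 (by decide), hs'.i 1 (by decide), h1]
  · rw [hs₂.i 6 (by decide), hs₁.i 6 (by decide), hs'.i 6 (by decide), h6]
  · rw [hs₂.i 10 (by decide), hs₁.i 10 (by decide), hs'.i 10 (by decide), h10]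
  · intro j hj
    rw [hs₂.ia 5 (by decide), hs₁.ia 5 (by decide), hI5 j hj]
  · have hfeas : (s₁.ireg 13 ≤ 0 ∧ s₁.ireg 12 + s₁.ireg 8 ≤ s₁.ireg 1) ↔
        Feasible n k a m (s'.iarr 5) := by
      rw [hsize, hsum, hs₁.i 8 (by decide), hs'.i 8 (by decide), h8, hs₁.i 1 (by decide),
        hs'.i 1 (by decide), h1, hs'.ia 4 (by decide)]
      simp only [h4, Feasible]
    rw [hs'.ia 2 (by decide), hc] at hv
    have e6 : s₁.rreg 6 = s'.rreg 6 := hs₁.r 6 (by decide)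
    have e66 : s₁.iarr 6 = s'.iarr 6 := hs₁.ia 6 (by decide)
    have e5 : s₁.iarr 5 = s'.iarr 5 := hs₁.ia 5 (by decide)
    have f6 : s₃.rreg 6 = s₂.rreg 6 := hs₃.r 6 (by decide)
    have f66 : s₃.iarr 6 = s₂.iarr 6 := hs₃.ia 6 (by decide)
    have hcur : multVal d n a c m (multVec k q t) = s₁.rreg 7 := by
      rw [hv]; exact multVal_congr fun i hi => (hI5 i hi).symm
    rw [hfeas, e6, e66, e5] at hupd
    rw [f6, f66]
    refine ⟨ht, hn5, ?_, ?_⟩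
    · rw [hn11]
      refine if_congr ⟨fun h => ?_, fun h => h ▸ dvd_rfl⟩ rfl rfl
      exact le_antisymm ht (Nat.le_of_dvd (Nat.succ_pos t) h)
    rcases hupd with ⟨hf, hle, hr6', hb6⟩ | ⟨himp, hr6', hb6⟩
    · refine ⟨hf.congr fun i hi => (hb6 i hi).symm, ?_, fun t' ht' hft' => ?_⟩
      · rw [hr6', hv]; exact multVal_congr fun i hi => (hb6 i hi).symm
      · rw [hr6']
        rcases Nat.lt_succ_iff_lt_or_eq.1 ht' with ht' | rfl
        · exact (hIb t' ht' hft').trans hle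
        · exact hcur.le
    · refine ⟨by rwa [hb6], by rw [hr6', hb6, hIr], fun t' ht' hft' => ?_⟩
      rw [hr6']
      rcases Nat.lt_succ_iff_lt_or_eq.1 ht' with ht' | rfl
      · exact hIb t' ht' hft'
      · rw [hcur]
        exact himp (hft'.congr fun i hi => (hI5 i hi).symm)

end RealRAM

/-! ### Writing the output -/

namespace RealRAM

open Finset

variable {d : ℕ → ℕ → ℝ} {n k : ℕ}

/-- The points of `S` have been written to `iarr 0`, each exactly once; they are marked in `iarr 7`
and counted in `ireg 14`. -/
structure Emitted (n : ℕ) (S : Finset ℕ) (s : State) : Prop where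
  sub : S ⊆ range n
  count : s.ireg 14 = S.card
  mark : ∀ u, s.iarr 7 u = if u ∈ S then 1 else 0
  mem : ∀ i < S.card, s.iarr 0 i ∈ S
  inj : ∀ i < S.card, ∀ j < S.card, s.iarr 0 i = s.iarr 0 j → i = j

theorem Emitted.congr {S : Finset ℕ} {s s' : State} (h : Emitted n S s)
    (h14 : s'.ireg 14 = s.ireg 14) (h7 : s'.iarr 7 = s.iarr 7) (h0 : s'.iarr 0 = s.iarr 0) :
    Emitted n S s' :=
  ⟨h.sub, h14.trans h.count, h7 ▸ h.mark, h0 ▸ h.mem, h0 ▸ h.inj⟩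

theorem Emitted.insert {S : Finset ℕ} {s s' : State} {u : ℕ} (h : Emitted n S s) (hu : u < n)
    (huS : u ∉ S) (h14 : s'.ireg 14 = s.ireg 14 + 1)
    (h7 : ∀ v, s'.iarr 7 v = if v = u then 1 else s.iarr 7 v)
    (h0 : ∀ i, s'.iarr 0 i = if i = s.ireg 14 then u else s.iarr 0 i) :
    Emitted n (insert u S) s' := by
  have hlt : ∀ i < S.card, s'.iarr 0 i = s.iarr 0 i := fun i hi => by
    rw [h0, h.count, if_neg hi.ne]
  have heq : s'.iarr 0 S.card = u := by rw [h0, h.count, if_pos rfl]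
  refine ⟨insert_subset (by simpa using hu) h.sub, ?_, fun v => ?_, fun i hi => ?_,
    fun i hi j hj hij => ?_⟩
  · rw [card_insert_of_notMem huS, h14, h.count]
  · rw [h7, h.mark]
    by_cases hv : v = u <;> simp [hv]
  · rw [card_insert_of_notMem huS] at hi
    rcases Nat.lt_succ_iff_lt_or_eq.1 hi with hi | rfl
    · rw [hlt i hi]; exact mem_insert_of_mem (h.mem i hi)
    · rw [heq]; exact mem_insert_self _ _
  · rw [card_insert_of_notMem huS] at hi hj
    rcases Nat.lt_succ_iff_lt_or_eq.1 hi with hi | rfl <;>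
      rcases Nat.lt_succ_iff_lt_or_eq.1 hj with hj | rfl
    · rw [hlt i hi, hlt j hj] at hij
      exact h.inj i hi j hj hij
    · rw [hlt i hi, heq] at hij
      exact absurd (hij ▸ h.mem i hi) huS
    · rw [hlt j hj, heq] at hij
      exact absurd (hij ▸ h.mem j hj) huS
    · rfl

/-- The point `ireg 3` is added to the output. -/
def emitProg : Prog :=
  .seq (.istore 0 (.reg 14) (.reg 3))
    (.seq (.istore 7 (.reg 3) (.const 1)) (.iset 14 (.add (.reg 14) (.const 1))))

/-- The output of all far points and of `iarr 6 j` points of the cluster with label `j + 1`. -/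
def pickProg : Prog :=
  .forN 3 (.reg 0)
    (.ite (.ile (.get 3 (.reg 3)) (.const 0)) emitProg
      (.ite (.ile (.const 1) (.get 6 (.sub (.get 3 (.reg 3)) (.const 1))))
        (.seq emitProg (.istore 6 (.sub (.get 3 (.reg 3)) (.const 1))
          (.sub (.get 6 (.sub (.get 3 (.reg 3)) (.const 1))) (.const 1)))) .skip))

theorem cell_succ_subset_iff {a : ℕ → ℕ} {i j : ℕ} {S : Finset ℕ} :
    cell (i + 1) a j ⊆ S ↔ cell i a j ⊆ S ∧ (a i = j → i ∈ S) := by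
  simp only [subset_iff, mem_cell, Nat.lt_succ_iff_lt_or_eq]
  constructor
  · exact fun h => ⟨fun u hu => h ⟨.inl hu.1, hu.2⟩, fun hi => h ⟨.inr rfl, hi⟩⟩
  · rintro ⟨h1, h2⟩ u ⟨hu | rfl, hu'⟩
    exacts [h1 ⟨hu, hu'⟩, h2 hu']

theorem runs_pickProg {s : State} {m : ℕ} {a : ℕ → ℕ} (h0 : s.ireg 0 = n) (ha : s.iarr 3 = a)
    (hm : ∀ u < n, a u ≤ m) (hE : Emitted n ∅ s) (hf : Feasible n k a m (s.iarr 6)) :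
    Runs d pickProg s (8 + n * 60) fun s' => ∃ S, Emitted n S s' ∧ S.card ≤ k ∧
      cell n a 0 ⊆ S ∧ ∀ j < m, s.iarr 6 j = (S ∩ cell n a (j + 1)).card := by
  refine (Runs.forN (N := n) (I := fun i s' => ∃ S ⊆ range i, Emitted n S s' ∧ cell i a 0 ⊆ S ∧
    ∀ j < m, s'.iarr 6 j + (S.filter (a · = j + 1)).card = s.iarr 6 j ∧
      (s'.iarr 6 j = 0 ∨ cell i a (j + 1) ⊆ S)) ?_ ?_
    fun i s' hi hs' ⟨S, hSi, hSE, hS0, hSj⟩ hx => Runs.of_wp ?_).mono ?_ ?_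
  · refine ⟨∅, by simp, hE.congr (by simp) (by simp) (by simp), by simp [cell], fun j _ => ?_⟩
    simp [cell]
  · intro i s' hs' _
    rw [IExpr.eval, hs'.i 0 (by decide), h0]
  · have e3 : s'.iarr 3 = a := by rw [hs'.ia 3 (by decide), ha]
    have hiS : i ∉ S := fun h => by simpa using hSi h
    have hSi' : S ⊆ range (i + 1) := hSi.trans (range_subset_range.2 (Nat.le_succ i))
    have hins : insert i S ⊆ range (i + 1) :=
      insert_subset (by simp) hSi'
    simp only [emitProg, Prog.wp, BExpr.eval, IExpr.eval, e3, hx, State.ireg_setIReg,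
      State.iarr_setIReg, State.ireg_setIArr, State.iarr_setIArr, Nat.reduceEqDiff, reduceIte,
      false_and]
    refine ⟨fun hb => ?_, fun hb => ⟨fun hb' => ?_, fun hb' => ?_⟩⟩
    · have hai : a i = 0 := Nat.le_zero.1 hb
      refine ⟨trivial, insert i S, hins, ?_, ?_, fun j hj => ?_⟩
      · exact hSE.insert hi hiS (by simp) (fun v => by simp) (fun v => by simp)
      · exact cell_succ_subset_iff.2 ⟨hS0.trans (subset_insert _ _), fun _ => mem_insert_self _ _⟩
      · rw [filter_insert, if_neg (by omega)]
        refine ⟨by simpa using (hSj j hj).1, (hSj j hj).2.imp (fun h => by simpa using h)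
          fun h => ?_⟩
        exact cell_succ_subset_iff.2 ⟨h.trans (subset_insert _ _), fun _ => mem_insert_self _ _⟩
    · have hai : a i - 1 + 1 = a i := by omega
      refine ⟨trivial, insert i S, hins, ?_, ?_, fun j hj => ?_⟩
      · exact hSE.insert hi hiS (by simp) (fun v => by simp) (fun v => by simp)
      · exact cell_succ_subset_iff.2 ⟨hS0.trans (subset_insert _ _), fun _ => mem_insert_self _ _⟩
      · rw [filter_insert]
        by_cases hj' : a i = j + 1
        · have e : a i - 1 = j := by omega
          have := (hSj j hj).1
          rw [if_pos hj', card_insert_of_notMem (by simp [hiS])]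
          simp only [e] at hb' ⊢
          simp at hb' ⊢
          refine ⟨by omega, ?_⟩
          rcases (hSj j hj).2 with h | h
          · omega
          · exact .inr (cell_succ_subset_iff.2 ⟨h.trans (subset_insert _ _),
              fun _ => mem_insert_self _ _⟩)
        · have e : j ≠ a i - 1 := by omega
          rw [if_neg hj']
          simp [e]
          exact ⟨(hSj j hj).1, (hSj j hj).2.imp id fun h =>
            cell_succ_subset_iff.2 ⟨h.trans (subset_insert _ _), fun _ => mem_insert_self _ _⟩⟩
    · refine ⟨trivial, S, hSi', ?_, ?_, fun j hj => ⟨(hSj j hj).1, ?_⟩⟩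
      · exact hSE.congr (by simp) (by simp) (by simp)
      · exact cell_succ_subset_iff.2 ⟨hS0, fun h => absurd h (by omega)⟩
      · by_cases hj' : a i = j + 1
        · have e : a i - 1 = j := by omega
          rw [e] at hb'
          exact .inl (by simpa using hb')
        · exact (hSj j hj).2.imp id fun h => cell_succ_subset_iff.2 ⟨h, fun h => absurd h hj'⟩
  · simp only [emitProg, Prog.maxCost, IExpr.cost, BExpr.cost]
    refine Nat.add_le_add (by norm_num) (Nat.mul_le_mul_left n (m := 60) ?_)
    omega
  · rintro s' - ⟨S, hSn, hSE, hS0, hSj⟩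
    have hinter : ∀ j, S ∩ cell n a j = S.filter (a · = j) := by
      intro j
      ext u
      simp only [mem_inter, mem_cell, mem_filter]
      exact ⟨fun h => ⟨h.1, h.2.2⟩, fun h => ⟨h.1, by simpa using hSn h.1, h.2⟩⟩
    have hcount : ∀ j < m, s.iarr 6 j = (S ∩ cell n a (j + 1)).card := by
      intro j hj
      obtain ⟨h1, h2⟩ := hSj j hj
      rw [← hinter] at h1
      rcases h2 with h2 | h2
      · omega
      · have := hf.1 j hj
        rw [inter_eq_right.2 h2] at h1 ⊢
        omega
    refine ⟨S, hSE, ?_, hS0, hcount⟩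
    have h1 : S.card = ∑ j ∈ range (m + 1), (S.filter (a · = j)).card :=
      card_eq_sum_card_fiberwise fun u hu => by
        have := hm u (by simpa using hSn hu)
        simp only [coe_range, Set.mem_Iio]
        omega
    rw [sum_range_succ', ← hinter 0, inter_eq_right.2 hS0] at h1
    have h2 : ∑ j ∈ range m, (S.filter (a · = j + 1)).card = ∑ j ∈ range m, s.iarr 6 j :=
      sum_congr rfl fun j hj => by rw [← hinter, hcount j (mem_range.1 hj)]
    rw [h1, h2]
    exact hf.2

/-- The output is filled up to `k` points. -/
def fillProg : Prog :=
  .forN 3 (.reg 0)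
    (.ite (.conj (.ile (.get 7 (.reg 3)) (.const 0)) (.ile (.add (.reg 14) (.const 1)) (.reg 1)))
      emitProg .skip)

theorem runs_fillProg {s : State} {S : Finset ℕ} (h0 : s.ireg 0 = n) (h1 : s.ireg 1 = k)
    (hkn : k ≤ n) (hE : Emitted n S s) (hS : S.card ≤ k) :
    Runs d fillProg s (8 + n * 40) fun s' => ∃ T, S ⊆ T ∧ Emitted n T s' ∧ T.card = k := by
  refine (Runs.forN (N := n) (I := fun i s' => ∃ T, S ⊆ T ∧ Emitted n T s' ∧ T.card ≤ k ∧
    (T.card = k ∨ range i ⊆ T)) ?_ ?_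
    fun i s' hi hs' ⟨T, hST, hTE, hTk, hT⟩ hx => Runs.of_wp ?_).mono ?_ ?_
  · exact ⟨S, subset_rfl, hE.congr (by simp) (by simp) (by simp), hS, .inr (by simp)⟩
  · intro i s' hs' _
    rw [IExpr.eval, hs'.i 0 (by decide), h0]
  · have e1 : s'.ireg 1 = k := by rw [hs'.i 1 (by decide), h1]
    simp only [emitProg, Prog.wp, BExpr.eval, IExpr.eval, e1, hx, hTE.mark, hTE.count,
      State.ireg_setIReg, State.ireg_setIArr, Nat.reduceEqDiff, reduceIte]
    refine ⟨fun ⟨hb, hb'⟩ => ?_, fun hb => ?_⟩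
    · have hiT : i ∉ T := fun h => by simp [h] at hb
      refine ⟨trivial, insert i T, hST.trans (subset_insert _ _), ?_, ?_, ?_⟩
      · exact hTE.insert hi hiT (by simp [hTE.count]) (fun v => by simp)
          (fun v => by simp [hTE.count])
      · rw [card_insert_of_notMem hiT]; exact hb'
      · refine hT.imp (fun h => by omega) fun h => ?_
        rw [range_add_one]
        exact insert_subset_insert _ h
    · refine ⟨trivial, T, hST, hTE.congr (by simp) (by simp) (by simp), hTk, ?_⟩
      by_cases hk : T.card = k
      · exact .inl hk
      · have hiT : i ∈ T := by
          by_contra hiT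
          exact hb ⟨by simp [hiT], by omega⟩
        refine hT.imp id fun h => ?_
        rw [range_add_one]
        exact insert_subset hiT h
  · simp only [emitProg, Prog.maxCost, IExpr.cost, BExpr.cost]
    refine Nat.add_le_add (by norm_num) (Nat.mul_le_mul_left n (m := 40) ?_)
    omega
  · rintro s' - ⟨T, hST, hTE, hTk, hT⟩
    refine ⟨T, hST, hTE, ?_⟩
    rcases hT with hT | hT
    · exact hT
    · have := card_le_card hT
      rw [card_range] at this
      omega

end RealRAM

/-! ### The size of a net in a doubling space -/

theorem HalfRadiusCover.mono {X : Type*} [PseudoMetricSpace X] {D D' : ℝ}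
    (h : HalfRadiusCover X D) (hD : D ≤ D') : HalfRadiusCover X D' := fun u r hr => by
  obtain ⟨V, hV, hc⟩ := h u r hr
  exact ⟨V, hV.trans (Real.rpow_le_rpow_of_exponent_le (by norm_num) hD), hc⟩

theorem HalfRadiusCover.iterate {X : Type*} [PseudoMetricSpace X] {D : ℝ}
    (h : HalfRadiusCover X D) (x : X) {r : ℝ} (hr : 0 < r) (j : ℕ) :
    ∃ V : Finset X, (V.card : ℝ) ≤ ((2 : ℝ) ^ D) ^ j ∧
      Metric.closedBall x r ⊆ ⋃ v ∈ V, Metric.closedBall v (r / 2 ^ j) := by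
  classical
  induction j with
  | zero => exact ⟨{x}, by simp, by simp⟩
  | succ j ih =>
    obtain ⟨V, hV, hc⟩ := ih
    choose U hU hUc using fun v : X => h v (r / 2 ^ j) (by positivity)
    refine ⟨V.biUnion U, ?_, fun y hy => ?_⟩
    · calc ((V.biUnion U).card : ℝ) ≤ ∑ v ∈ V, ((U v).card : ℝ) := by
            exact_mod_cast Finset.card_biUnion_le
        _ ≤ ∑ v ∈ V, (2 : ℝ) ^ D := Finset.sum_le_sum fun v _ => hU v
        _ = V.card * (2 : ℝ) ^ D := by rw [Finset.sum_const, nsmul_eq_mul]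
        _ ≤ ((2 : ℝ) ^ D) ^ j * (2 : ℝ) ^ D := by gcongr
        _ = _ := (pow_succ _ _).symm
    · obtain ⟨v, hv, hyv⟩ := Set.mem_iUnion₂.1 (hc hy)
      obtain ⟨w, hw, hyw⟩ := Set.mem_iUnion₂.1 (hUc v hyv)
      refine Set.mem_iUnion₂.2 ⟨w, Finset.mem_biUnion.2 ⟨v, hv, hw⟩, ?_⟩
      rwa [pow_succ, ← div_div]

/-- An `η`-separated set in a ball of radius `r` has at most one point in each of the balls of radius
`r / 2 ^ j ≤ η / 2` that cover the ball. -/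
theorem HalfRadiusCover.card_le {X : Type*} [PseudoMetricSpace X] {D : ℝ}
    (h : HalfRadiusCover X D) (x : X) {r η : ℝ} (hr : 0 < r) {j : ℕ} (hj : 2 * r ≤ 2 ^ j * η)
    {C : Finset X} (hC : ∀ y ∈ C, dist y x ≤ r) (hsep : ∀ y ∈ C, ∀ y' ∈ C, y ≠ y' → η < dist y y') :
    (C.card : ℝ) ≤ ((2 : ℝ) ^ D) ^ j := by
  obtain ⟨V, hV, hc⟩ := h.iterate x hr j
  refine le_trans ?_ hV
  have hf : ∀ y ∈ C, ∃ v ∈ V, dist y v ≤ r / 2 ^ j := fun y hy => by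
    obtain ⟨v, hv, hyv⟩ := Set.mem_iUnion₂.1 (hc (Metric.mem_closedBall.2 (hC y hy)))
    exact ⟨v, hv, hyv⟩
  have : C.card ≤ V.card := Finset.card_le_card_of_forall_subsingleton
    (fun y v => dist y v ≤ r / 2 ^ j) hf fun v _ y ⟨hy, hyv⟩ y' ⟨hy', hyv'⟩ => by
      by_contra hne
      have h1 := hsep y hy y' hy' hne
      have h2 := dist_triangle_right y y' v
      have h3 : 2 * (r / 2 ^ j) ≤ η := by
        rw [mul_div_assoc', div_le_iff₀ (by positivity), mul_comm η]
        exact hj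
      have h4 : dist y v ≤ r / 2 ^ j := hyv
      have h5 : dist y' v ≤ r / 2 ^ j := hyv'
      linarith
  exact_mod_cast this

namespace RealRAM

open Finset

/-- A net of width `ε * W / k` in a ball of radius `25 * W / k` has at most `(100 / ε) ^ D` points,
also in the degenerate case `W = 0`. -/
theorem card_net_le {X : Type*} [PseudoMetricSpace X] {n : ℕ} (e : Fin n ≃ X) {D ε W κ : ℝ}
    (hD : 0 ≤ D) (hX : HalfRadiusCover X D) (hε : 0 < ε) (hε1 : ε ≤ 1) (hW : 0 ≤ W) (hκ : 0 < κ)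
    {z : ℕ} (hz : z < n) {C : Finset ℕ} (hCn : C ⊆ range n)
    (hC : ∀ x ∈ C, oracle e z x ≤ 25 * W / κ)
    (hsep : ∀ x ∈ C, ∀ y ∈ C, x ≠ y → ε * W / κ < oracle e x y) :
    (C.card : ℝ) ≤ (100 / ε) ^ D := by
  classical
  have hd := isPMetric_oracle e
  have hone : (1 : ℝ) ≤ 100 / ε := by rw [le_div_iff₀ hε]; linarith
  rcases hW.eq_or_lt with rfl | hW
  · have hcard : C.card ≤ 1 := card_le_one.2 fun x hx y hy => by
      by_contra hne
      have h1 := hsep x hx y hy hne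
      have h2 := hd.tri x z y hz
      have h3 := hC x hx
      have h4 := hC y hy
      rw [hd.symm x z] at h2
      simp only [mul_zero, zero_div] at h1 h3 h4
      linarith
    calc (C.card : ℝ) ≤ 1 := by exact_mod_cast hcard
      _ ≤ _ := Real.one_le_rpow hone hD
  -- `i + 1` halvings bring the radius down to between a quarter and half of the width
  · obtain ⟨i, hi1, hi2⟩ := exists_nat_pow_near (x := 50 / ε) (y := (2 : ℝ))
      (by rw [le_div_iff₀ hε]; linarith) (by norm_num)
    have hpt : ∀ x ∈ C, x < n := fun x hx => by simpa using hCn hx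
    let C' : Finset X := C.attach.image fun x => e ⟨x.1, hpt x.1 x.2⟩
    have hcard : C'.card = C.card := by
      rw [card_image_of_injective, card_attach]
      intro x y hxy
      have := e.injective hxy
      exact Subtype.ext (by simpa using this)
    have hmain := hX.card_le (e ⟨z, hz⟩) (r := 25 * W / κ) (η := ε * W / κ) (by positivity)
      (j := i + 1) (C := C') ?_ ?_ ?_
    · rw [hcard] at hmain
      refine hmain.trans ?_
      rw [← Real.rpow_mul_natCast (by norm_num), mul_comm, Real.rpow_natCast_mul (by norm_num)]
      refine Real.rpow_le_rpow (by positivity) ?_ hD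
      rw [pow_succ]
      calc (2 : ℝ) ^ i * 2 ≤ 50 / ε * 2 := by gcongr
        _ = 100 / ε := by ring
    · rw [mul_div_assoc', mul_div_assoc', div_le_div_iff_of_pos_right hκ]
      rw [div_lt_iff₀ hε] at hi2
      nlinarith
    · intro y hy
      obtain ⟨x, -, rfl⟩ := mem_image.1 hy
      have := hC x.1 x.2
      rw [oracle, dif_pos ⟨hz, hpt x.1 x.2⟩, dist_comm] at this
      exact this
    · intro y hy y' hy' hne
      obtain ⟨x, -, rfl⟩ := mem_image.1 hy
      obtain ⟨x', -, rfl⟩ := mem_image.1 hy'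
      have := hsep x.1 x.2 x'.1 x'.2 fun h => hne (by simp [h])
      rwa [oracle, dif_pos ⟨hpt x.1 x.2, hpt x'.1 x'.2⟩] at this

/-! ### The running time -/

/-- The search over the multiplicities is fast enough: since `ε⁻¹ * log k` exceeds both `2` and
`ε⁻¹ ^ (1 / 2)`, all quantities are bounded by powers of it. -/
theorem search_time_le {D ε : ℝ} {k M L : ℕ} (hD : 0 ≤ D) (hε : 0 < ε) (hε1 : 128 * ε < 1)
    (hk : 2 ≤ k) (hM : (M : ℝ) ≤ (100 / ε) ^ D) (hM1 : 1 ≤ M) (hL : (L : ℝ) ≤ 2 * M / ε) :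
    ((L ^ M * (212 * M ^ 2) : ℕ) : ℝ) ≤
      (ε⁻¹ * Real.log k) ^ ((8 + 18 * D + (3 + 9 * D) * 100 ^ D) * ε ^ (-D)) * k := by
  set b := ε⁻¹ * Real.log k with hb
  have hk' : (2 : ℝ) ≤ k := by exact_mod_cast hk
  have hlog : (0.69 : ℝ) ≤ Real.log k :=
    le_trans (by linarith [Real.log_two_gt_d9]) (Real.log_le_log (by norm_num) hk')
  have hinv : (128 : ℝ) ≤ ε⁻¹ := by rw [le_inv_comm₀ (by norm_num) hε]; linarith
  have hb1 : 0.69 * ε⁻¹ ≤ b := by rw [hb, mul_comm]; gcongr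
  have hb2 : (2 : ℝ) ≤ b := by linarith
  have hb0 : (0 : ℝ) < b := by linarith
  have hεb : ε⁻¹ ≤ b ^ (2 : ℝ) := by
    rw [Real.rpow_two]; nlinarith
  have h2b : ∀ N : ℕ, (2 : ℝ) ^ N ≤ b ^ (N : ℝ) := fun N => by
    rw [Real.rpow_natCast]; gcongr
  have hE : (1 : ℝ) ≤ ε ^ (-D) := by
    rw [Real.rpow_neg hε.le, ← Real.inv_rpow hε.le]
    exact Real.one_le_rpow (by linarith) hD
  have hMb : (M : ℝ) ≤ b ^ (9 * D) := by
    refine hM.trans ?_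
    have : 100 / ε ≤ b ^ (9 : ℝ) := by
      rw [show (9 : ℝ) = (7 : ℕ) + 2 by norm_num, Real.rpow_add hb0, div_eq_mul_inv]
      have := h2b 7
      gcongr
      linarith
    rw [Real.rpow_mul hb0.le]
    exact Real.rpow_le_rpow (by positivity) this hD
  have hM0 : (1 : ℝ) ≤ M := by exact_mod_cast hM1
  have hLb : (L : ℝ) ≤ b ^ (3 + 9 * D) := by
    refine hL.trans ?_
    rw [show 3 + 9 * D = (1 : ℕ) + 9 * D + 2 by push_cast; ring, Real.rpow_add hb0,
      Real.rpow_add hb0, div_eq_mul_inv]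
    have := h2b 1
    gcongr
    linarith
  have hME : (M : ℝ) ≤ 100 ^ D * ε ^ (-D) := by
    rwa [Real.div_rpow (by norm_num) hε.le, div_eq_mul_inv, ← Real.rpow_neg hε.le] at hM
  have hpow : (L : ℝ) ^ M ≤ b ^ ((3 + 9 * D) * (100 ^ D * ε ^ (-D))) := by
    calc (L : ℝ) ^ M ≤ (b ^ (3 + 9 * D)) ^ M := by gcongr
      _ = b ^ ((3 + 9 * D) * M) := (Real.rpow_mul_natCast hb0.le _ _).symm
      _ ≤ _ := Real.rpow_le_rpow_of_exponent_le (by linarith) (by gcongr)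
  have hM2 : 212 * (M : ℝ) ^ 2 ≤ b ^ ((8 + 18 * D) * ε ^ (-D)) := by
    calc 212 * (M : ℝ) ^ 2 ≤ b ^ ((8 : ℕ) : ℝ) * (b ^ (9 * D)) ^ 2 := by
          have := h2b 8
          gcongr
          linarith
      _ = b ^ (8 + 18 * D) := by
          rw [← Real.rpow_mul_natCast hb0.le, ← Real.rpow_add hb0]
          congr 1; push_cast; ring
      _ ≤ _ := Real.rpow_le_rpow_of_exponent_le (by linarith) (by
          have : 0 ≤ 8 + 18 * D := by positivity
          nlinarith)
  calc ((L ^ M * (212 * M ^ 2) : ℕ) : ℝ) = (L : ℝ) ^ M * (212 * (M : ℝ) ^ 2) := by push_cast; ring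
    _ ≤ b ^ ((3 + 9 * D) * (100 ^ D * ε ^ (-D))) * b ^ ((8 + 18 * D) * ε ^ (-D)) := by gcongr
    _ = b ^ ((8 + 18 * D + (3 + 9 * D) * 100 ^ D) * ε ^ (-D)) := by
        rw [← Real.rpow_add hb0]; congr 1; ring
    _ ≤ _ := le_mul_of_one_le_right (by positivity) (by linarith)

end RealRAM

/-! ### The algorithm -/

namespace RealRAM

open Finset

variable {d : ℕ → ℕ → ℝ} {n k : ℕ}

/-- There are at most `k` far points, as an optimal set contains them all. Hence the zero vector of
multiplicities, with which the search starts, is feasible. -/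
theorem FarWalk.card_far_le (hd : IsPMetric d n) {V : Finset ℕ} {z m : ℕ} {W η : ℝ} {a c : ℕ → ℕ}
    (hw : FarWalk d n V z W) (hV : V.card = k) (hk : 2 ≤ k)
    (h : Clustering d n z (25 * W / k) η a c m) : (cell n a 0).card ≤ k := by
  obtain ⟨O, hO, hmax⟩ := exists_max_image (powersetCard k (range n)) (cliqueVal d)
    ⟨V, mem_powersetCard.2 ⟨hw.sub, hV⟩⟩
  obtain ⟨hOn, hOk⟩ := mem_powersetCard.1 hO
  rw [← hOk]
  refine card_le_card fun u hu => ?_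
  obtain ⟨hun, hu0⟩ := mem_cell.1 hu
  exact hw.mem_of_far hd hV hk hOn hOk (fun T' h1 h2 => hmax T' (mem_powersetCard.2 ⟨h1, h2⟩)) hun
    ((h.far u hun).1 hu0)

/-- The part of the algorithm that outputs the far points and an optimal number of points of each
cluster. -/
def coreProg : Prog :=
  .seq walkProg (.seq netProg (.seq farSumProg (.seq stepProg (.seq searchProg pickProg))))

/-- The approximation algorithm. For `1 ≤ 128 * ε` every set of `k` points will do. -/
def mainProg : Prog :=
  .seq (.ite (.rle (.ofNat (.const 1)) (.mul (.ofNat (.const 128)) (.reg 0))) .skip coreProg)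
    fillProg

theorem emitted_initState (n k : ℕ) (ε : ℝ) : Emitted n ∅ (initState n k ε) :=
  ⟨by simp, by simp [initState], fun u => by simp [initState], by simp, by simp⟩

theorem runs_coreProg (hd : IsPMetric d n) {ε : ℝ} {M : ℕ} (hk : 2 ≤ k) (hkn : k ≤ n) (hε : 0 < ε)
    (hε1 : 128 * ε < 1)
    (hM : ∀ (z : ℕ) (W : ℝ) (C : Finset ℕ), z < n → 0 ≤ W → C ⊆ range n →
      (∀ x ∈ C, d z x ≤ 25 * W / k) → (∀ x ∈ C, ∀ y ∈ C, x ≠ y → ε * W / k < d x y) →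
      C.card ≤ M) :
    Runs d coreProg (initState n k ε)
      (400 * (n * (k + M)) + (⌊M / ε⌋₊ + 1) ^ M * (212 * M ^ 2)) fun s => ∃ S, Emitted n S s ∧
        S.card ≤ k ∧ ∀ T, S ⊆ T → T ⊆ range n → T.card = k → ∀ T' ⊆ range n, T'.card = k →
          (1 - 128 * ε) * cliqueVal d T' ≤ cliqueVal d T := by
  refine ((runs_walkProg (k := k) hd rfl rfl rfl rfl (fun _ => rfl) (by omega) hkn).seq
    fun s₁ hs₁ ⟨V, hV, hVk⟩ => ?_).mono (B₁ := 13 + k * (40 + n * 28) +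
      ((25 + n * (65 + M * 19)) + ((8 + M * (30 + n * 30)) + ((14 + k * 16) +
        ((4 + (⌊M / ε⌋₊ + 1) ^ M * (70 + M * (120 + M * 22))) + (8 + n * 60)))))) ?_
      fun _ _ h => h
  · have hz : s₁.ireg 4 < n := by simpa using hV.sub hV.mem
    have hη0 : 0 ≤ ε * s₁.rreg 1 / k := by have := hV.nonneg; positivity
    have a1 : s₁.ireg 1 = k := by rw [hs₁.i 1 (by decide)]; rfl
    have ar0 : s₁.rreg 0 = ε := by rw [hs₁.r 0 (by decide)]; rfl
    refine (runs_netProg (M := M) hd (n := n) ?_ ?_ ?_ ?_ ?_ rfl rfl ?_ ?_).seq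
      fun s₂ hs₂ ⟨hnet, hmM⟩ => ?_
    · rw [hs₁.i 0 (by decide)]; rfl
    · rw [hs₁.i 6 (by decide)]; rfl
    · rw [hs₁.i 8 (by decide)]; rfl
    · intro u; rw [hs₁.ia 3 (by decide)]; rfl
    · intro u; rw [hs₁.ia 4 (by decide)]; rfl
    · rwa [a1, ar0]
    · intro C h1 h2 h3
      rw [a1] at h2 h3
      rw [ar0] at h3
      exact hM _ _ C hz hV.nonneg h1 h2 h3
    rw [a1, ar0] at hnet
    have hclu := hnet.clustering
    have hm : 0 < s₂.ireg 6 := by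
      have h1 := hclu.label_le _ hz
      have h2 : s₂.iarr 3 (s₁.ireg 4) ≠ 0 := by
        rw [Ne, hclu.far _ hz, hd.self, not_lt]
        have := hV.nonneg
        positivity
      omega
    have b1 : s₂.ireg 1 = k := by rw [hs₂.i 1 (by decide), a1]
    have br0 : s₂.rreg 0 = ε := by rw [hs₂.r 0 (by decide), ar0]
    have b0 : s₂.ireg 0 = n := by rw [hs₂.i 0 (by decide), hs₁.i 0 (by decide)]; rfl
    refine ((runs_farSumProg b0).mono (B₂ := 8 + M * (30 + n * 30))
      (Nat.add_le_add le_rfl (Nat.mul_le_mul_right _ hmM)) fun _ _ h => h).seq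
      fun s₃ hs₃ hfs => ?_
    have c1 : s₃.ireg 1 = k := by rw [hs₃.i 1 (by decide), b1]
    have c6 : s₃.ireg 6 = s₂.ireg 6 := hs₃.i 6 (by decide)
    have cr0 : s₃.rreg 0 = ε := by rw [hs₃.r 0 (by decide), br0]
    have hstep := runs_stepProg (d := d) (s := s₃) (by rwa [c6]) (by rw [cr0]; exact hε.le)
      (by rw [cr0]; linarith)
    rw [c1, c6, cr0] at hstep
    refine hstep.seq fun s₄ hs₄ ⟨hq, hq1, hq2⟩ => ?_
    have e2 : s₄.iarr 2 = s₂.iarr 2 := by rw [hs₄.ia 2 (by decide), hs₃.ia 2 (by decide)]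
    have e3 : s₄.iarr 3 = s₂.iarr 3 := by rw [hs₄.ia 3 (by decide), hs₃.ia 3 (by decide)]
    refine ((runs_searchProg (n := n) (k := k) (a := s₂.iarr 3) (c := s₂.iarr 2) (m := s₂.ireg 6)
      ?_ ?_ rfl hq ?_ ?_ ?_ e2 ?_ ?_ ?_ ?_ (hV.card_far_le hd hVk hk hclu)).mono ?_
      fun _ _ h => h).seq fun s₅ hs₅ ⟨hfeas, hbest⟩ => ?_
    · rw [hs₄.i 1 (by decide), c1]
    · rw [hs₄.i 6 (by decide), c6]
    · rw [hs₄.i 11 (by decide), hs₃.i 11 (by decide), hs₂.i 11 (by decide), hs₁.i 11 (by decide)]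
      rfl
    · rw [hs₄.i 8 (by decide), hs₃.i 8 (by decide), hnet.far_eq]
    · intro j
      rw [hs₄.ia 4 (by decide), hs₃.ia 4 (by decide), hnet.size_eq]
    · intro j hj
      rw [hs₄.ra 0 (by decide), hfs j hj]
    · intro j
      rw [hs₄.ia 5 (by decide), hs₃.ia 5 (by decide), hs₂.ia 5 (by decide), hs₁.ia 5 (by decide)]
      rfl
    · intro j
      rw [hs₄.ia 6 (by decide), hs₃.ia 6 (by decide), hs₂.ia 6 (by decide), hs₁.ia 6 (by decide)]
      rfl
    · rw [hs₄.r 6 (by decide), hs₃.r 6 (by decide), hs₂.r 6 (by decide), hs₁.r 6 (by decide)]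
      simp [initState]
    · have hkq : k / s₄.ireg 10 ≤ ⌊M / ε⌋₊ := by
        have hq0 : (0 : ℝ) < s₄.ireg 10 := by exact_mod_cast hq
        refine Nat.le_floor (Nat.cast_div_le.trans ?_)
        rw [div_le_div_iff₀ hq0 hε, mul_comm (k : ℝ)]
        refine hq2.le.trans ?_
        rw [mul_comm]
        gcongr
      refine Nat.add_le_add le_rfl (Nat.mul_le_mul ?_ ?_)
      · exact (Nat.pow_le_pow_left (Nat.succ_le_succ hkq) _).trans
          (Nat.pow_le_pow_right (Nat.succ_pos _) hmM)
      · gcongr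
    have f3 : s₅.iarr 3 = s₂.iarr 3 := by rw [hs₅.ia 3 (by decide), e3]
    refine (runs_pickProg (k := k) (m := s₂.ireg 6) ?_ f3 hclu.label_le ?_ hfeas).mono le_rfl
      fun s₆ hs₆ ⟨S, hSE, hSk, hSF, hSj⟩ => ⟨S, hSE, hSk, fun T hST hT hTk T' hT' hT'k =>
        hclu.approx hd hV hVk hk hε hε1.le hq hq1 hbest hT hTk hST hSF hSj hT' hT'k⟩
    · rw [hs₅.i 0 (by decide), hs₄.i 0 (by decide), hs₃.i 0 (by decide), b0]
    · refine (emitted_initState n k ε).congr ?_ ?_ ?_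
      · rw [hs₅.i 14 (by decide), hs₄.i 14 (by decide), hs₃.i 14 (by decide),
          hs₂.i 14 (by decide), hs₁.i 14 (by decide)]
      · rw [hs₅.ia 7 (by decide), hs₄.ia 7 (by decide), hs₃.ia 7 (by decide),
          hs₂.ia 7 (by decide), hs₁.ia 7 (by decide)]
      · rw [hs₅.ia 0 (by decide), hs₄.ia 0 (by decide), hs₃.ia 0 (by decide),
          hs₂.ia 0 (by decide), hs₁.ia 0 (by decide)]
  · have hM1 : 1 ≤ M := by
      have := hM 0 0 {0} (by omega) le_rfl (by simp; omega) (by simp [hd.self]) (by simp)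
      simpa using this
    have h1 : 70 + M * (120 + M * 22) ≤ 212 * M ^ 2 := by nlinarith
    have h2 := Nat.mul_le_mul_left ((⌊M / ε⌋₊ + 1) ^ M) h1
    have h3 : 1 * M ≤ n * M := Nat.mul_le_mul_right M (by omega)
    have h4 : n * 2 ≤ n * k := Nat.mul_le_mul_left n hk
    have h5 : n * 1 ≤ n * M := Nat.mul_le_mul_left n hM1
    nlinarith

/-- The running time that `runs_coreProg` and `runs_fillProg` add up to, in the form of the
theorem. -/
theorem total_time_le {D ε : ℝ} (hD : 0 ≤ D) (hε : 0 < ε) (hε1 : 128 * ε < 1) (hk : 2 ≤ k)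
    (hkn : k ≤ n) :
    ((17 + (400 * (n * (k + ⌊(100 / ε) ^ D⌋₊)) +
        (⌊⌊(100 / ε) ^ D⌋₊ / ε⌋₊ + 1) ^ ⌊(100 / ε) ^ D⌋₊ * (212 * ⌊(100 / ε) ^ D⌋₊ ^ 2)) +
        n * 40 : ℕ) : ℝ) ≤
      500 * 100 ^ D * (n * (k + ε ^ (-D))) +
      (ε⁻¹ * Real.log k) ^ ((8 + 18 * D + (3 + 9 * D) * 100 ^ D) * ε ^ (-D)) * k := by
  have hone : (1 : ℝ) ≤ (100 / ε) ^ D :=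
    Real.one_le_rpow (by rw [le_div_iff₀ hε]; linarith) hD
  have hMle := Nat.floor_le (zero_le_one.trans hone)
  have hM1 : 1 ≤ ⌊(100 / ε) ^ D⌋₊ := Nat.le_floor (by simpa using hone)
  generalize ⌊(100 / ε) ^ D⌋₊ = M at hMle hM1
  have hM0 : (1 : ℝ) ≤ M := by exact_mod_cast hM1
  have hL : ((⌊M / ε⌋₊ + 1 : ℕ) : ℝ) ≤ 2 * M / ε := by
    push_cast
    have h1 : (⌊M / ε⌋₊ : ℝ) ≤ M / ε := Nat.floor_le (by positivity)
    have h2 : 1 ≤ M / ε := by rw [le_div_iff₀ hε]; linarith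
    have h3 : 2 * (M : ℝ) / ε = M / ε + M / ε := by ring
    linarith
  have hs := search_time_le hD hε hε1 hk hMle hM1 hL
  have hME : (M : ℝ) ≤ 100 ^ D * ε ^ (-D) := by
    rwa [Real.div_rpow (by norm_num) hε.le, div_eq_mul_inv, ← Real.rpow_neg hε.le] at hMle
  have hcD : (1 : ℝ) ≤ 100 ^ D := Real.one_le_rpow (by norm_num) hD
  have hk' : (2 : ℝ) ≤ k := by exact_mod_cast hk
  have hn' : (2 : ℝ) ≤ n := by exact_mod_cast hk.trans hkn
  have h1 : (n : ℝ) * (k + M) ≤ 100 ^ D * (n * (k + ε ^ (-D))) := by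
    have : (k : ℝ) ≤ 100 ^ D * k := le_mul_of_one_le_left (by linarith) hcD
    calc (n : ℝ) * (k + M) ≤ n * (100 ^ D * k + 100 ^ D * ε ^ (-D)) := by gcongr
      _ = _ := by ring
  have h2 : (n : ℝ) * 2 ≤ n * (k + M) := by gcongr; linarith
  push_cast at hs ⊢
  nlinarith

theorem runs_mainProg (hd : IsPMetric d n) {D ε : ℝ} (hD : 0 ≤ D) (hk : 2 ≤ k) (hkn : k ≤ n)
    (hε : 0 < ε)
    (hM : 128 * ε < 1 → ∀ (z : ℕ) (W : ℝ) (C : Finset ℕ), z < n → 0 ≤ W → C ⊆ range n →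
      (∀ x ∈ C, d z x ≤ 25 * W / k) → (∀ x ∈ C, ∀ y ∈ C, x ≠ y → ε * W / k < d x y) →
      (C.card : ℝ) ≤ (100 / ε) ^ D) :
    ∃ t s T, Exec d mainProg (initState n k ε) t s ∧
      (t : ℝ) ≤ 500 * 100 ^ D * (n * (k + ε ^ (-D))) +
        (ε⁻¹ * Real.log k) ^ ((8 + 18 * D + (3 + 9 * D) * 100 ^ D) * ε ^ (-D)) * k ∧
      Emitted n T s ∧ T.card = k ∧ ∀ T' ⊆ range n, T'.card = k →
        (1 - 128 * ε) * cliqueVal d T' ≤ cliqueVal d T := by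
  have hval : ∀ T : Finset ℕ, 0 ≤ cliqueVal d T := fun T =>
    mul_nonneg (by norm_num) (sum_nonneg fun u _ => sum_nonneg fun v _ => hd.nonneg u v)
  by_cases hε1 : 128 * ε < 1
  · have hcore := runs_coreProg (M := ⌊(100 / ε) ^ D⌋₊) hd hk hkn hε hε1
      fun z W C h1 h2 h3 h4 h5 => Nat.le_floor (hM hε1 z W C h1 h2 h3 h4 h5)
    obtain ⟨t, s, hex, ht, T, hTE, hTk, hT⟩ := (Runs.ite (b := .rle (.ofNat (.const 1))
      (.mul (.ofNat (.const 128)) (.reg 0))) (p := .skip)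
      (fun hb => absurd hb (by
        simpa [BExpr.eval, RExpr.eval, IExpr.eval, initState] using hε1)) fun _ => hcore).seq
      fun s₁ hs₁ ⟨S, hSE, hSk, hS⟩ => (runs_fillProg (k := k) (by rw [hs₁.i 0 (by decide)]; rfl)
        (by rw [hs₁.i 1 (by decide)]; rfl) hkn hSE hSk).mono le_rfl
        fun s₂ _ ⟨T, hST, hTE, hTk⟩ => (⟨T, hTE, hTk, hS T hST hTE.sub hTk⟩ :
          ∃ T, Emitted n T s₂ ∧ T.card = k ∧ ∀ T' ⊆ range n, T'.card = k →
            (1 - 128 * ε) * cliqueVal d T' ≤ cliqueVal d T)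
    refine ⟨t, s, T, hex, le_trans ?_ (total_time_le hD hε hε1 hk hkn), hTE, hTk, hT⟩
    refine Nat.cast_le.2 (ht.trans ?_)
    simp only [BExpr.cost, RExpr.cost, IExpr.cost]
    omega
  · obtain ⟨t, s, hex, ht, T, -, hTE, hTk⟩ := (Runs.ite (b := .rle (.ofNat (.const 1))
      (.mul (.ofNat (.const 128)) (.reg 0))) (q := coreProg) (s := initState n k ε) (d := d)
      (B := 1) (Q := fun s => s = initState n k ε)
      (fun _ => ⟨_, _, .skip _, le_rfl, rfl⟩) (fun hb => absurd (by
        simpa [BExpr.eval, RExpr.eval, IExpr.eval, initState] using hε1) hb)).seq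
      fun s₁ hs₁ h => (runs_fillProg (k := k) (S := ∅) (by rw [h]; rfl) (by rw [h]; rfl) hkn
        (h ▸ emitted_initState n k ε) (by simp))
    refine ⟨t, s, T, hex, ?_, hTE, hTk, fun T' _ _ => ?_⟩
    · have hcD : (1 : ℝ) ≤ 100 ^ D := Real.one_le_rpow (by norm_num) hD
      have hk' : (2 : ℝ) ≤ k := by exact_mod_cast hk
      have hn' : (2 : ℝ) ≤ n := by exact_mod_cast hk.trans hkn
      have h1 : (t : ℝ) ≤ 17 + n * 40 := by
        have : t ≤ 17 + n * 40 := ht.trans (by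
          simp only [BExpr.cost, RExpr.cost, IExpr.cost]; omega)
        exact_mod_cast this
      have h2 : 0 ≤ ε ^ (-D) := by positivity
      have h3 : 1 * ((n : ℝ) * 2) ≤ 100 ^ D * (n * (k + ε ^ (-D))) := by
        gcongr; linarith
      have h4 : 0 ≤ (ε⁻¹ * Real.log k) ^ ((8 + 18 * D + (3 + 9 * D) * 100 ^ D) * ε ^ (-D)) * k := by
        have : 0 ≤ Real.log k := Real.log_nonneg (by linarith)
        positivity
      linarith
    · have := mul_nonpos_of_nonpos_of_nonneg (by linarith : 1 - 128 * ε ≤ 0) (hval T')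
      exact this.trans (hval T)

theorem cliqueVal_oracle {X : Type*} [PseudoMetricSpace X] {n : ℕ} (e : Fin n ≃ X)
    (S : Finset (Fin n)) :
    cliqueVal (oracle e) (S.map Fin.valEmbedding) = remoteClique (S.map e.toEmbedding) := by
  unfold cliqueVal remoteClique
  simp [sum_map, oracle]

end RealRAM

theorem theorem3 :
    ∃ (P : RealRAM.Prog) (A : ℝ), 0 < A ∧
      ∀ D : ℝ, 0 ≤ D → ∃ C₁ C₂ : ℝ, 0 < C₁ ∧ 0 < C₂ ∧
        ∀ (X : Type*) [PseudoMetricSpace X] (n k : ℕ) (e : Fin n ≃ X) (ε : ℝ),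
          doublingDim X ≤ D → 2 ≤ k → k ≤ n → 0 < ε →
          ∃ (t : ℕ) (s : RealRAM.State) (T : Finset X),
            RealRAM.Exec (RealRAM.oracle e) P (RealRAM.initState n k ε) t s ∧
            (t : ℝ) ≤ C₁ * (n * (k + ε ^ (-D)))
              + (ε⁻¹ * Real.log k) ^ (C₂ * ε ^ (-D)) * k ∧
            RealRAM.Outputs e k s T ∧ T.card = k ∧
            ∀ T' : Finset X, T'.card = k → (1 - A * ε) * remoteClique T' ≤ remoteClique T := by
  refine ⟨RealRAM.mainProg, 128, by norm_num, fun D hD => ⟨500 * 100 ^ D,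
    8 + 18 * D + (3 + 9 * D) * 100 ^ D, by positivity, by positivity,
    fun X _ n k e ε hdim hk hkn hε => ?_⟩⟩
  have : Finite X := Finite.of_equiv _ e
  have hX : HalfRadiusCover X D := (isLeast_doublingDim X).1.2.mono hdim
  obtain ⟨t, s, T, hex, ht, hTE, hTk, hT⟩ := RealRAM.runs_mainProg (RealRAM.isPMetric_oracle e) hD hk hkn hε
    fun hε1 z W C hz hW hCn hC hsep => RealRAM.card_net_le e hD hX hε (by linarith) hW
      (by have : 0 < k := by omega
          exact_mod_cast this) hz hCn hC hsep
  have hmem : ∀ i : Fin k, s.iarr 0 i ∈ T := fun i => hTE.mem i (hTk.symm ▸ i.2)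
  have hlt : ∀ i : Fin k, s.iarr 0 i < n := fun i => by simpa using hTE.sub (hmem i)
  let f : Fin k ↪ Fin n := ⟨fun i => ⟨s.iarr 0 i, hlt i⟩, fun i j hij =>
    Fin.ext (hTE.inj i (hTk.symm ▸ i.2) j (hTk.symm ▸ j.2) (by simpa using hij))⟩
  have hTf : (Finset.univ.map f).map Fin.valEmbedding = T := by
    refine Finset.eq_of_subset_of_card_le (fun u hu => ?_) (by simp [hTk])
    simp only [Finset.mem_map, Finset.mem_univ, true_and] at hu
    obtain ⟨_, ⟨i, rfl⟩, rfl⟩ := hu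
    exact hmem i
  refine ⟨t, s, (Finset.univ.map f).map e.toEmbedding, hex, ht,
    ⟨f.trans e.toEmbedding, Finset.map_map _ _ _, fun i => by
      change _ = ((e.symm (e (f i)) : Fin n) : ℕ)
      rw [Equiv.symm_apply_apply]
      rfl⟩, by simp,
    fun T' hT'k => ?_⟩
  have h1 := hT ((T'.map e.symm.toEmbedding).map Fin.valEmbedding)
    (fun u hu => by
      obtain ⟨i, -, rfl⟩ := Finset.mem_map.1 hu
      simp) (by simpa using hT'k)
  rw [← hTf, RealRAM.cliqueVal_oracle, RealRAM.cliqueVal_oracle] at h1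
  have h2 : (T'.map e.symm.toEmbedding).map e.toEmbedding = T' := by
    rw [Finset.map_map]
    ext x
    simp
  rwa [h2] at h1
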